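/- Let $0<q<1$. Let $\mathcal O(SU_q(2))$ be the unital complex $*$-algebra with generators $a,b,c,d$, relations $ab=qba$, $ac=qca$, $bd=qdb$, $cd=qdc$, $bc=cb$, $ad-qbc=da-q^{-1}bc=1$, and involution $a^*=d$, $b^*=-qc$, $c^*=-q^{-1}b$, $d^*=a$, with the coproduct $\Delta(u_{ij})=\sum_k u_{ik}\otimes u_{kj}$ for $u=\begin{pmatrix}a&b\\c&d\end{pmatrix}$. Let $h$ be its Haar functional (the unique linear functional with $h(1)=1$ and $(\mathrm{id}\otimes h)\Delta(f)=h(f)1=(h\otimes\mathrm{id})\Delta(f)$), and let $L^2(SU_q(2))$ be the Hilbert space completion of $\mathcal O(SU_q(2))$ for the inner product $\langle y,x\rangle=h(xy^*)$. For $l\in\frac12\mathbb N=\{0,\frac12,1,\dots\}$ let $T^{l}=[t^l_{ij}]_{-l\le i,j\le l}$ be the matrix of the unitary irreducible corepresentation on the homogeneous polynomials of degree $2l$ on the quantum plane $xy=qyx$ (coaction $x\mapsto x\otimes a+y\otimes c$, $y\mapsto x\otimes b+y\otimes d$), with respect to the basis $\binom{2l}{l+i}_{q^{-2}}^{1/2}x^{l-i}y^{l+i}$,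 $-l\le i\le l$. For $f\in L^2(SU_q(2))$ put $\hat f(l)_{mn}=\langle t^l_{nm},f\rangle$ (which is $h(f(t^l_{nm})^*)$ for $f\in\mathcal O(SU_q(2))$). Put $[n]_q=\frac{q^n-q^{-n}}{q-q^{-1}}$ and $\mathrm{Tr}_q(M)=\sum_{i=-l}^{l}q^{-2i}M_{ii}$. A symbol is a function $\sigma$ assigning to each $l\in\frac12\mathbb N$ a matrix $\sigma(l)\in M_{2l+1}(\mathbb C)\otimes\mathcal O(SU_q(2))$. A linear operator $A$ in $L^2(SU_q(2))$, whose domain is a linear subspace containing $\mathcal O(SU_q(2))$, is called a pseudo-differential operator with symbol $\sigma$ if for every $f$ in its domain $$Af=\sum_{l\in\frac12\mathbb N}[2l+1]_q\,\mathrm{Tr}_q\big(\sigma(l)\hat f(l)T^{l}\big),$$ the series converging unconditionally in $L^2(SU_q(2))$. A symbol $\sigma$ is homogeneous of Fourier order $m\in\frac12\mathbb N$ if for each $l$ there is a map $\psi(l):\{-l,\dots,l\}^2\to(\frac12\mathbb Z)^2$ such that $\sigma(l)_{ij}\in\mathrm{Span}\{t^m_{\psi(l)(i,j)}\}$ if $\psi(l)(i,j)\in\{-m,\dots,m\}^2$,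 and $\sigma(l)_{ij}=0$ otherwise; $\Phi^m(SU_q(2))$ is the linear span of these symbols. (So the symbols in $\Phi^0(SU_q(2))$ are those all of whose entries are scalar multiples of $1$.) **Theorem (Composition Formula I).** Let $A$ and $B$ be pseudo-differential operators on $SU_q(2)$ with symbols $\sigma_A,\sigma_B\in\Phi^0(SU_q(2))$. Then the composition $A\circ B$, on its natural domain $\{f\in\mathrm{dom}\,B: Bf\in\mathrm{dom}\,A\}$, is a pseudo-differential operator, and the pointwise product $\sigma_{A\circ B}(l)=\sigma_A(l)\sigma_B(l)$, $l\in\frac12\mathbb N$, is its symbol. -/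

import Mathlib

set_option linter.unusedSimpArgs false

open scoped TensorProduct ComplexConjugate InnerProductSpace

noncomputable section

namespace SUq2

/-! ### The coordinate algebra of the quantum group -/

/-- The deformation parameter, a real number with `0 < q < 1`. -/
abbrev Param : Type := Set.Ioo (0 : ℝ) 1

/-- The deformation parameter as a complex number. -/
def cq (q : Param) : ℂ := ((q : ℝ) : ℂ)

theorem q_pos (q : Param) : (0 : ℝ) < q := q.2.1
theorem q_lt (q : Param) : (q : ℝ) < 1 := q.2.2
theorem q_ne (q : Param) : (q : ℝ) ≠ 0 := (q_pos q).ne'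
theorem cq_ne (q : Param) : cq q ≠ 0 := by unfold cq; exact_mod_cast q_ne q
theorem conj_cq (q : Param) : conj (cq q) = cq q := Complex.conj_ofReal _

/-- The four generators of the coordinate algebra. -/
inductive Gen : Type
  | a | b | c | d

/-- The free algebra on four generators. -/
abbrev Free : Type := FreeAlgebra ℂ Gen

/-- The defining relations of `SU_q(2)` for the matrix `[a, b; c, d]`. -/
inductive Rel (q : Param) : Free → Free → Prop
  | ab : Rel q (FreeAlgebra.ι ℂ Gen.a * FreeAlgebra.ι ℂ Gen.b)
      (cq q • (FreeAlgebra.ι ℂ Gen.b * FreeAlgebra.ι ℂ Gen.a))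
  | ac : Rel q (FreeAlgebra.ι ℂ Gen.a * FreeAlgebra.ι ℂ Gen.c)
      (cq q • (FreeAlgebra.ι ℂ Gen.c * FreeAlgebra.ι ℂ Gen.a))
  | bd : Rel q (FreeAlgebra.ι ℂ Gen.b * FreeAlgebra.ι ℂ Gen.d)
      (cq q • (FreeAlgebra.ι ℂ Gen.d * FreeAlgebra.ι ℂ Gen.b))
  | cd : Rel q (FreeAlgebra.ι ℂ Gen.c * FreeAlgebra.ι ℂ Gen.d)
      (cq q • (FreeAlgebra.ι ℂ Gen.d * FreeAlgebra.ι ℂ Gen.c))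
  | bc : Rel q (FreeAlgebra.ι ℂ Gen.b * FreeAlgebra.ι ℂ Gen.c)
      (FreeAlgebra.ι ℂ Gen.c * FreeAlgebra.ι ℂ Gen.b)
  | ad : Rel q (FreeAlgebra.ι ℂ Gen.a * FreeAlgebra.ι ℂ Gen.d)
      (1 + cq q • (FreeAlgebra.ι ℂ Gen.b * FreeAlgebra.ι ℂ Gen.c))
  | da : Rel q (FreeAlgebra.ι ℂ Gen.d * FreeAlgebra.ι ℂ Gen.a)
      (1 + (cq q)⁻¹ • (FreeAlgebra.ι ℂ Gen.b * FreeAlgebra.ι ℂ Gen.c))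

/-- The coordinate algebra `𝒪(SU_q(2))`: generators `a, b, c, d` and the relations above. -/
def Coord (q : Param) : Type := RingQuot (Rel q)

instance (q : Param) : Ring (Coord q) := inferInstanceAs (Ring (RingQuot (Rel q)))
instance (q : Param) : Algebra ℂ (Coord q) := inferInstanceAs (Algebra ℂ (RingQuot (Rel q)))

/-- The class of a generator. -/
def gen (q : Param) (g : Gen) : Coord q := RingQuot.mkAlgHom ℂ (Rel q) (FreeAlgebra.ι ℂ g)

/-- The defining relations, for four elements of an arbitrary algebra. -/
structure IsQuad (q : Param) {B : Type*} [Ring B] [Algebra ℂ B] (f : Gen → B) : Prop where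
  ab : f .a * f .b = cq q • (f .b * f .a)
  ac : f .a * f .c = cq q • (f .c * f .a)
  bd : f .b * f .d = cq q • (f .d * f .b)
  cd : f .c * f .d = cq q • (f .d * f .c)
  bc : f .b * f .c = f .c * f .b
  ad : f .a * f .d = 1 + cq q • (f .b * f .c)
  da : f .d * f .a = 1 + (cq q)⁻¹ • (f .b * f .c)

/-- The universal property of the coordinate algebra. -/
def lift (q : Param) {B : Type*} [Ring B] [Algebra ℂ B] (f : Gen → B) (hf : IsQuad q f) :
    Coord q →ₐ[ℂ] B :=
  RingQuot.liftAlgHom ℂ ⟨FreeAlgebra.lift ℂ f, by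
    intro x y h
    induction h with
    | ab => simpa using hf.ab
    | ac => simpa using hf.ac
    | bd => simpa using hf.bd
    | cd => simpa using hf.cd
    | bc => simpa using hf.bc
    | ad => simpa using hf.ad
    | da => simpa using hf.da⟩

@[simp] theorem lift_gen (q : Param) {B : Type*} [Ring B] [Algebra ℂ B] (f : Gen → B)
    (hf : IsQuad q f) (g : Gen) : lift q f hf (gen q g) = f g := by
  unfold lift gen
  erw [RingQuot.liftAlgHom_mkAlgHom_apply]
  simp

theorem isQuad_gen (q : Param) : IsQuad q (gen q) where
  ab := by
    have h := RingQuot.mkAlgHom_rel ℂ (Rel.ab (q := q))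
    simp only [map_mul, map_add, map_one, map_smul] at h
    exact h
  ac := by
    have h := RingQuot.mkAlgHom_rel ℂ (Rel.ac (q := q))
    simp only [map_mul, map_add, map_one, map_smul] at h
    exact h
  bd := by
    have h := RingQuot.mkAlgHom_rel ℂ (Rel.bd (q := q))
    simp only [map_mul, map_add, map_one, map_smul] at h
    exact h
  cd := by
    have h := RingQuot.mkAlgHom_rel ℂ (Rel.cd (q := q))
    simp only [map_mul, map_add, map_one, map_smul] at h
    exact h
  bc := by
    have h := RingQuot.mkAlgHom_rel ℂ (Rel.bc (q := q))
    simp only [map_mul, map_add, map_one, map_smul] at h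
    exact h
  ad := by
    have h := RingQuot.mkAlgHom_rel ℂ (Rel.ad (q := q))
    simp only [map_mul, map_add, map_one, map_smul] at h
    exact h
  da := by
    have h := RingQuot.mkAlgHom_rel ℂ (Rel.da (q := q))
    simp only [map_mul, map_add, map_one, map_smul] at h
    exact h

/-- An induction principle: the coordinate algebra is generated by `a, b, c, d`. -/
theorem coord_induction {q : Param} {P : Coord q → Prop} (hs : ∀ z : ℂ, P (algebraMap ℂ _ z))
    (hg : ∀ g, P (gen q g)) (hadd : ∀ x y, P x → P y → P (x + y))
    (hmul : ∀ x y, P x → P y → P (x * y)) (x : Coord q) : P x := by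
  obtain ⟨y, rfl⟩ := RingQuot.mkAlgHom_surjective ℂ (Rel q) x
  induction y using FreeAlgebra.induction with
  | grade0 z =>
    have h := hs z
    have e := AlgHom.commutes (RingQuot.mkAlgHom ℂ (Rel q)) z
    exact (congrArg P e).mpr h
  | grade1 g => exact hg g
  | mul x y hx hy => rw [map_mul]; exact hmul _ _ hx hy
  | add x y hx hy => rw [map_add]; exact hadd _ _ hx hy

/-! ### The involution -/

/-- The opposite of the coordinate algebra with conjugated scalars, as a complex algebra. -/
def ConjOp (q : Param) : Type := (Coord q)ᵐᵒᵖ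

instance (q : Param) : Ring (ConjOp q) := inferInstanceAs (Ring (Coord q)ᵐᵒᵖ)
instance (q : Param) : Algebra ℂ (ConjOp q) :=
  ((algebraMap ℂ (Coord q)ᵐᵒᵖ).comp (starRingEnd ℂ)).toAlgebra'
    (fun z x => Algebra.commutes (A := (Coord q)ᵐᵒᵖ) (conj z) x)

/-- An element of the coordinate algebra, as an element of the opposite algebra. -/
def toConjOp (q : Param) (x : Coord q) : ConjOp q := MulOpposite.op x

theorem toConjOp_mul (q : Param) (x y : Coord q) :
    toConjOp q x * toConjOp q y = toConjOp q (y * x) := rfl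

theorem toConjOp_add (q : Param) (x y : Coord q) :
    toConjOp q x + toConjOp q y = toConjOp q (x + y) := rfl

theorem toConjOp_one (q : Param) : (1 : ConjOp q) = toConjOp q 1 := rfl

theorem smul_toConjOp (q : Param) (z : ℂ) (x : Coord q) :
    z • toConjOp q x = toConjOp q (conj z • x) := by
  rw [Algebra.smul_def, Algebra.smul_def, Algebra.commutes (conj z) x]
  rfl

theorem toConjOp_algebraMap (q : Param) (z : ℂ) :
    algebraMap ℂ (ConjOp q) z = toConjOp q (algebraMap ℂ _ (conj z)) := rfl

/-- The values of the involution on generators: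
`a* = d`, `b* = -q c`, `c* = -q⁻¹ b`, `d* = a`. -/
def starGen (q : Param) : Gen → Coord q
  | .a => gen q .d
  | .b => (-cq q) • gen q .c
  | .c => (-(cq q)⁻¹) • gen q .b
  | .d => gen q .a

theorem isQuad_star (q : Param) : IsQuad q (fun g => toConjOp q (starGen q g)) := by
  have h := isQuad_gen q
  have hq := cq_ne q
  constructor <;>
    simp only [starGen, toConjOp_mul, toConjOp_add, toConjOp_one, smul_toConjOp, smul_mul_assoc,
      mul_smul_comm, smul_smul, map_inv₀, conj_cq, ← h.bc, h.ad, h.da, h.ab, h.ac,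
      h.bd, h.cd]
  case ad => congr 3; field_simp
  case da => congr 3; field_simp
  case bc => congr 2; ring
  all_goals congr 2; field_simp

/-- The involution as a homomorphism to the opposite algebra. -/
def starHom (q : Param) : Coord q →ₐ[ℂ] ConjOp q := lift q _ (isQuad_star q)

instance (q : Param) : Star (Coord q) := ⟨fun x => MulOpposite.unop (starHom q x)⟩

theorem toConjOp_star (q : Param) (x : Coord q) : toConjOp q (star x) = starHom q x := rfl

theorem toConjOp_inj {q : Param} {x y : Coord q} (h : toConjOp q x = toConjOp q y) : x = y :=
  MulOpposite.op_injective h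

theorem coord_star_mul (q : Param) (x y : Coord q) : star (x * y) = star y * star x :=
  toConjOp_inj (by rw [← toConjOp_mul, toConjOp_star, toConjOp_star, toConjOp_star, map_mul])

theorem coord_star_add (q : Param) (x y : Coord q) : star (x + y) = star x + star y :=
  toConjOp_inj (by rw [← toConjOp_add, toConjOp_star, toConjOp_star, toConjOp_star, map_add])

theorem coord_star_smul (q : Param) (z : ℂ) (x : Coord q) : star (z • x) = conj z • star x :=
  toConjOp_inj (by rw [← smul_toConjOp, toConjOp_star, toConjOp_star, map_smul])

theorem coord_star_algebraMap (q : Param) (z : ℂ) :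
    star (algebraMap ℂ (Coord q) z) = algebraMap ℂ (Coord q) (conj z) :=
  toConjOp_inj (by rw [toConjOp_star, AlgHom.commutes, toConjOp_algebraMap])

theorem coord_star_gen (q : Param) (g : Gen) : star (gen q g) = starGen q g :=
  toConjOp_inj (by rw [toConjOp_star, starHom, lift_gen])

instance (q : Param) : StarRing (Coord q) where
  star_involutive x := by
    induction x using coord_induction with
    | hs z => simp [coord_star_algebraMap]
    | hg g =>
      have hq := cq_ne q
      cases g <;> simp only [coord_star_gen, starGen, coord_star_smul, smul_smul, map_neg, conj_cq,
        map_inv₀, neg_mul_neg, mul_inv_cancel₀ hq, inv_mul_cancel₀ hq, one_smul]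
    | hadd x y hx hy => rw [coord_star_add, coord_star_add, hx, hy]
    | hmul x y hx hy => rw [coord_star_mul, coord_star_mul, hx, hy]
  star_mul := coord_star_mul q
  star_add := coord_star_add q

instance (q : Param) : StarModule ℂ (Coord q) := ⟨fun z x => coord_star_smul q z x⟩


/-! ### The Haar functional

The irreducible infinite-dimensional representation of the coordinate algebra on finitely
supported functions on `ℕ × ℤ`, and the explicit Haar functional obtained from it. -/

/-- Finitely supported functions on `ℕ × ℤ`, with standard basis `e_{n,k}`. -/
abbrev Fock : Type := ℕ × ℤ →₀ ℂ

/-- The basis vector `e_p`. -/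
abbrev basisVec (p : ℕ × ℤ) : Fock := Finsupp.single p 1

/-- The weighted shift `e_p ↦ w p • e_{s p}`. -/
def wshift (s : ℕ × ℤ → ℕ × ℤ) (w : ℕ × ℤ → ℂ) : Module.End ℂ Fock :=
  Finsupp.linearCombination ℂ (fun p => Finsupp.single (s p) (w p))

@[simp] theorem wshift_single (s : ℕ × ℤ → ℕ × ℤ) (w : ℕ × ℤ → ℂ) (p : ℕ × ℤ) (z : ℂ) :
    wshift s w (Finsupp.single p z) = Finsupp.single (s p) (z * w p) := by
  simp [wshift, Finsupp.linearCombination_single]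

/-- The number `√(1 - q ^ (2 n))`. -/
def sq (q : Param) (n : ℕ) : ℂ := ((Real.sqrt (1 - (q : ℝ) ^ (2 * n)) : ℝ) : ℂ)

theorem sq_zero (q : Param) : sq q 0 = 0 := by simp [sq]

theorem conj_sq (q : Param) (n : ℕ) : conj (sq q n) = sq q n := Complex.conj_ofReal _

theorem pow_le (q : Param) (n : ℕ) : (q : ℝ) ^ n ≤ 1 := pow_le_one₀ (q_pos q).le (q_lt q).le

theorem sq_mul_self (q : Param) (n : ℕ) : sq q n * sq q n = 1 - cq q ^ (2 * n) := by
  unfold sq cq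
  rw [← Complex.ofReal_mul, Real.mul_self_sqrt (sub_nonneg.mpr (pow_le q _))]
  push_cast
  rfl

/-- The action of the generators on the basis: `a e_{n,k} = √(1 - q^{2n}) e_{n-1,k}`,
`b e_{n,k} = -q^{n+1} e_{n,k-1}`, `c e_{n,k} = q^n e_{n,k+1}`,
`d e_{n,k} = √(1 - q^{2n+2}) e_{n+1,k}`. -/
def repGen (q : Param) : Gen → Module.End ℂ Fock
  | .a => wshift (fun p => (p.1 - 1, p.2)) (fun p => sq q p.1)
  | .b => wshift (fun p => (p.1, p.2 - 1)) (fun p => -cq q ^ (p.1 + 1))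
  | .c => wshift (fun p => (p.1, p.2 + 1)) (fun p => cq q ^ p.1)
  | .d => wshift (fun p => (p.1 + 1, p.2)) (fun p => sq q (p.1 + 1))

theorem end_ext {S T : Module.End ℂ Fock} (h : ∀ p, S (basisVec p) = T (basisVec p)) : S = T := by
  apply Finsupp.lhom_ext'
  intro p
  ext
  simpa using DFunLike.congr_fun (h p) _

theorem isQuad_rep (q : Param) : IsQuad q (repGen q) := by
  have hq := cq_ne q
  constructor <;> apply end_ext <;> rintro ⟨n, k⟩ <;>
    simp only [repGen, Module.End.mul_apply, wshift_single, LinearMap.smul_apply,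
      LinearMap.add_apply, Module.End.one_apply, Finsupp.smul_single, smul_eq_mul, one_mul,
      Nat.add_sub_cancel, sub_add_cancel, add_sub_cancel_right]
  case ab =>
    congr 1
    cases n with
    | zero => simp [sq_zero]
    | succ n => simp only [Nat.add_sub_cancel]; ring
  case ac =>
    congr 1
    cases n with
    | zero => simp [sq_zero]
    | succ n => simp only [Nat.add_sub_cancel]; ring
  case bd => congr 1; ring
  case cd => congr 1; ring
  case bc => congr 1; ring
  case ad =>
    rw [← Finsupp.single_add, sq_mul_self]
    congr 1
    ring
  case da =>
    cases n with
    | zero =>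
      simp only [sq_zero, zero_mul, Finsupp.single_zero]
      rw [← Finsupp.single_add]
      symm
      rw [Finsupp.single_eq_zero]
      field_simp
      ring
    | succ n =>
      simp only [Nat.add_sub_cancel]
      rw [← Finsupp.single_add, sq_mul_self]
      congr 1
      field_simp
      ring

/-- The representation of the coordinate algebra. -/
def rep (q : Param) : Coord q →ₐ[ℂ] Module.End ℂ Fock := lift q _ (isQuad_rep q)

/-- The `ℓ¹`-norm of a finitely supported function. -/
def normOne (v : Fock) : ℝ := v.sum fun _ z => ‖z‖

theorem normOne_of_subset (v : Fock) {s : Finset (ℕ × ℤ)} (h : v.support ⊆ s) :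
    normOne v = ∑ p ∈ s, ‖v p‖ := Finsupp.sum_of_support_subset _ h _ (by simp)

theorem normOne_nonneg (v : Fock) : 0 ≤ normOne v := Finset.sum_nonneg fun _ _ => norm_nonneg _

theorem normOne_single (p : ℕ × ℤ) (z : ℂ) : normOne (Finsupp.single p z) = ‖z‖ := by
  simp [normOne]

theorem normOne_add (u v : Fock) : normOne (u + v) ≤ normOne u + normOne v := by
  classical
  rw [normOne_of_subset (u + v) Finsupp.support_add,
    normOne_of_subset u (Finset.subset_union_left (s₂ := v.support)),
    normOne_of_subset v (Finset.subset_union_right (s₁ := u.support)),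
    ← Finset.sum_add_distrib]
  exact Finset.sum_le_sum fun p _ => norm_add_le _ _

theorem normOne_smul (z : ℂ) (v : Fock) : normOne (z • v) = ‖z‖ * normOne v := by
  rw [normOne_of_subset (z • v) Finsupp.support_smul, normOne_of_subset v subset_rfl,
    Finset.mul_sum]
  simp

theorem normOne_sum (s : Finset (ℕ × ℤ)) (f : ℕ × ℤ → Fock) :
    normOne (∑ p ∈ s, f p) ≤ ∑ p ∈ s, normOne (f p) :=
  Finset.le_sum_of_subadditive normOne (by simp [normOne]) normOne_add s f

theorem norm_le_normOne (v : Fock) (p : ℕ × ℤ) : ‖v p‖ ≤ normOne v := by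
  by_cases h : p ∈ v.support
  · exact Finset.single_le_sum (f := fun p => ‖v p‖) (fun _ _ => norm_nonneg _) h
  · rw [Finsupp.notMem_support_iff.mp h, norm_zero]
    exact normOne_nonneg v

theorem normOne_wshift (s : ℕ × ℤ → ℕ × ℤ) (w : ℕ × ℤ → ℂ) (hw : ∀ p, ‖w p‖ ≤ 1) (v : Fock) :
    normOne (wshift s w v) ≤ normOne v := by
  have h : wshift s w v = ∑ p ∈ v.support, v p • Finsupp.single (s p) (w p) := rfl
  rw [h]
  refine (normOne_sum _ _).trans (Finset.sum_le_sum fun p _ => ?_)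
  rw [normOne_smul, normOne_single]
  exact mul_le_of_le_one_right (norm_nonneg _) (hw p)

theorem rep_bounded (q : Param) (x : Coord q) :
    ∃ C : ℝ, 0 ≤ C ∧ ∀ v, normOne (rep q x v) ≤ C * normOne v := by
  induction x using coord_induction with
  | hs z =>
    refine ⟨‖z‖, norm_nonneg _, fun v => ?_⟩
    rw [AlgHom.commutes, Module.algebraMap_end_apply, normOne_smul]
  | hg g =>
    refine ⟨1, zero_le_one, fun v => ?_⟩
    have h1 : ∀ n, ‖sq q n‖ ≤ 1 := fun n => by
      rw [sq, Complex.norm_real, Real.norm_eq_abs, abs_of_nonneg (Real.sqrt_nonneg _)]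
      rw [Real.sqrt_le_one]
      linarith [pow_pos (q_pos q) (2 * n)]
    have h2 : ∀ n, ‖cq q ^ n‖ ≤ 1 := fun n => by
      rw [norm_pow, cq, Complex.norm_real, Real.norm_eq_abs, abs_of_pos (q_pos q)]
      exact pow_le q n
    rw [one_mul, rep, lift_gen]
    cases g
    · exact normOne_wshift _ _ (fun p => h1 _) v
    · exact normOne_wshift _ _ (fun p => by rw [norm_neg]; exact h2 _) v
    · exact normOne_wshift _ _ (fun p => h2 _) v
    · exact normOne_wshift _ _ (fun p => h1 _) v
  | hadd x y hx hy =>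
    obtain ⟨C, hC, hx⟩ := hx
    obtain ⟨D, hD, hy⟩ := hy
    refine ⟨C + D, add_nonneg hC hD, fun v => ?_⟩
    rw [map_add, LinearMap.add_apply, add_mul]
    exact (normOne_add _ _).trans (add_le_add (hx v) (hy v))
  | hmul x y hx hy =>
    obtain ⟨C, hC, hx⟩ := hx
    obtain ⟨D, hD, hy⟩ := hy
    refine ⟨C * D, mul_nonneg hC hD, fun v => ?_⟩
    rw [map_mul, Module.End.mul_apply, mul_assoc]
    exact (hx _).trans (mul_le_mul_of_nonneg_left (hy v) hC)

/-- The summand `(1 - q²) q^{2n} ⟨e_{n,0}, x e_{n,0}⟩` of the Haar functional. -/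
def haarTerm (q : Param) (x : Coord q) (n : ℕ) : ℂ :=
  (1 - cq q ^ 2) * cq q ^ (2 * n) * rep q x (basisVec (n, 0)) (n, 0)

theorem norm_cq (q : Param) : ‖cq q‖ = q := by
  rw [cq, Complex.norm_real, Real.norm_eq_abs, abs_of_pos (q_pos q)]

theorem qsq_lt (q : Param) : (q : ℝ) ^ 2 < 1 := pow_lt_one₀ (q_pos q).le (q_lt q) two_ne_zero

theorem summable_weight (q : Param) {f : ℕ → ℂ} {C : ℝ} (hf : ∀ n, ‖f n‖ ≤ C) :
    Summable fun n => (1 - cq q ^ 2) * cq q ^ (2 * n) * f n := by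
  have h1 : Summable fun n : ℕ => ‖(1 - cq q ^ 2)‖ * C * ((q : ℝ) ^ 2) ^ n :=
    (summable_geometric_of_lt_one (sq_nonneg _) (qsq_lt q)).mul_left _
  refine Summable.of_norm_bounded h1 fun n => ?_
  rw [norm_mul, norm_mul, norm_pow, norm_cq, ← pow_mul, mul_right_comm]
  exact mul_le_mul_of_nonneg_right (mul_le_mul_of_nonneg_left (hf n) (norm_nonneg _))
    (pow_nonneg (q_pos q).le _)

theorem summable_haarTerm (q : Param) (x : Coord q) : Summable (haarTerm q x) := by
  obtain ⟨C, hC, h⟩ := rep_bounded q x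
  refine summable_weight q (C := C) fun n => ?_
  refine (norm_le_normOne _ _).trans ((h _).trans ?_)
  rw [normOne_single, norm_one, mul_one]

/-- The Haar functional, in explicit form:
`h(x) = (1 - q²) ∑ₙ q^{2n} ⟨e_{n,0}, x e_{n,0}⟩`. -/
def haar (q : Param) : Coord q →ₗ[ℂ] ℂ where
  toFun x := ∑' n, haarTerm q x n
  map_add' x y := by
    rw [← (summable_haarTerm q x).tsum_add (summable_haarTerm q y)]
    congr 1
    ext n
    simp [haarTerm, mul_add]
  map_smul' z x := by
    rw [RingHom.id_apply, smul_eq_mul, ← tsum_mul_left]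
    congr 1
    ext n
    simp only [haarTerm, map_smul, LinearMap.smul_apply, Finsupp.smul_apply, smul_eq_mul]
    ring

theorem haar_apply (q : Param) (x : Coord q) : haar q x = ∑' n, haarTerm q x n := rfl

/-! ### Positivity of the Haar functional -/

/-- The standard sesquilinear form on finitely supported functions. -/
def form (u v : Fock) : ℂ := u.sum fun p z => conj z * v p

theorem form_add_left (u u' v : Fock) : form (u + u') v = form u v + form u' v :=
  Finsupp.sum_add_index' (by simp) (by intros; rw [map_add, add_mul])

theorem form_add_right (u v v' : Fock) : form u (v + v') = form u v + form u v' := by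
  simp [form, Finsupp.sum, mul_add, Finset.sum_add_distrib]

theorem form_smul_right (z : ℂ) (u v : Fock) : form u (z • v) = z * form u v := by
  simp only [form, Finsupp.sum, Finsupp.smul_apply, smul_eq_mul, Finset.mul_sum]
  exact Finset.sum_congr rfl fun _ _ => by ring

theorem form_single_left (p : ℕ × ℤ) (z : ℂ) (v : Fock) :
    form (Finsupp.single p z) v = conj z * v p := by simp [form]

theorem form_conj (u v : Fock) : conj (form u v) = form v u := by
  classical
  have h1 : form u v = ∑ p ∈ u.support ∪ v.support, conj (u p) * v p :=
    Finsupp.sum_of_support_subset _ Finset.subset_union_left _ (by simp)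
  have h2 : form v u = ∑ p ∈ u.support ∪ v.support, conj (v p) * u p :=
    Finsupp.sum_of_support_subset _ Finset.subset_union_right _ (by simp)
  rw [h1, h2, map_sum]
  exact Finset.sum_congr rfl fun p _ => by rw [map_mul, Complex.conj_conj, mul_comm]

theorem form_smul_left (z : ℂ) (u v : Fock) : form (z • u) v = conj z * form u v := by
  rw [← form_conj v, form_smul_right, map_mul, form_conj]

theorem form_self (u : Fock) : form u u = ((∑ p ∈ u.support, ‖u p‖ ^ 2 : ℝ) : ℂ) := by
  rw [form, Finsupp.sum, Complex.ofReal_sum]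
  refine Finset.sum_congr rfl fun p _ => ?_
  rw [← Complex.normSq_eq_norm_sq, Complex.normSq_eq_conj_mul_self]

theorem form_zero_left (v : Fock) : form 0 v = 0 := by simp [form]
theorem form_zero_right (v : Fock) : form v 0 = 0 := by simp [form]

theorem adj_of_basis {S T : Module.End ℂ Fock}
    (h : ∀ p r, form (S (basisVec p)) (basisVec r) = form (basisVec p) (T (basisVec r)))
    (u v : Fock) : form (S u) v = form u (T v) := by
  induction u using Finsupp.induction_linear with
  | zero => simp [form_zero_left]
  | add u u' hu hu' => rw [map_add, form_add_left, form_add_left, hu, hu']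
  | single p z =>
    induction v using Finsupp.induction_linear with
    | zero => simp [form_zero_right]
    | add u u' hu hu' => rw [map_add, form_add_right, form_add_right, hu, hu']
    | single r w =>
      have e1 : (Finsupp.single p z : Fock) = z • basisVec p := by simp
      have e2 : (Finsupp.single r w : Fock) = w • basisVec r := by simp
      rw [e1, e2, map_smul, map_smul, form_smul_left, form_smul_left, form_smul_right,
        form_smul_right, h]

theorem rep_star (q : Param) (x : Coord q) (u v : Fock) :
    form (rep q x u) v = form u (rep q (star x) v) := by
  induction x using coord_induction generalizing u v with
  | hs z =>
    rw [coord_star_algebraMap, AlgHom.commutes, AlgHom.commutes, Module.algebraMap_end_apply,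
      Module.algebraMap_end_apply, form_smul_left, form_smul_right]
  | hg g =>
    refine adj_of_basis ?_ u v
    rintro ⟨n, k⟩ ⟨m, j⟩
    have hq := cq_ne q
    rw [coord_star_gen]
    cases g <;>
    simp only [starGen, map_smul, rep, lift_gen, repGen, wshift_single, LinearMap.smul_apply,
      Finsupp.smul_single, form_single_left, Finsupp.single_apply, Prod.mk.injEq, one_mul,
      map_one, conj_sq, map_neg, map_pow, conj_cq, smul_eq_mul]
    · by_cases hk : j = k
      · subst hk
        cases n with
        | zero => simp [sq_zero]
        | succ n =>
          by_cases hn : m = n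
          · subst hn; simp
          · simp [hn]
      · simp [hk]
    · by_cases hn : m = n
      · subst hn
        by_cases hk : j = k - 1
        · subst hk; simp; ring
        · have : ¬ (j + 1 = k) := fun h => hk (by omega)
          simp [hk, this]
      · simp [hn]
    · by_cases hn : m = n
      · subst hn
        by_cases hk : j = k + 1
        · subst hk; simp; field_simp; ring
        · have : ¬ (j - 1 = k) := fun h => hk (by omega)
          simp [hk, this]
      · simp [hn]
    · by_cases hk : j = k
      · subst hk
        cases m with
        | zero => simp [sq_zero]
        | succ m =>
          by_cases hn : m = n
          · subst hn; simp
          · simp [hn]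
      · simp [hk]
  | hadd x y hx hy =>
    rw [star_add, map_add, map_add, LinearMap.add_apply, LinearMap.add_apply, form_add_left,
      form_add_right, hx, hy]
  | hmul x y hx hy =>
    rw [star_mul, map_mul, map_mul, Module.End.mul_apply, Module.End.mul_apply, hx, hy]

theorem haarTerm_mul_star (q : Param) (x y : Coord q) (n : ℕ) :
    haarTerm q (y * star x) n = (1 - cq q ^ 2) * cq q ^ (2 * n) *
      form (rep q (star y) (basisVec (n, 0))) (rep q (star x) (basisVec (n, 0))) := by
  rw [haarTerm, rep_star, star_star, map_mul, Module.End.mul_apply, form_single_left, map_one,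
    one_mul]

theorem haar_conj (q : Param) (x y : Coord q) :
    conj (haar q (x * star y)) = haar q (y * star x) := by
  rw [haar_apply, haar_apply, Complex.conj_tsum]
  congr 1
  ext n
  rw [haarTerm_mul_star, haarTerm_mul_star, map_mul, form_conj]
  simp [conj_cq]

theorem haar_nonneg (q : Param) (x : Coord q) : 0 ≤ (haar q (x * star x)).re := by
  rw [haar_apply, Complex.re_tsum (summable_haarTerm q _)]
  refine tsum_nonneg fun n => ?_
  rw [haarTerm_mul_star, form_self]
  have h : (1 - cq q ^ 2) * cq q ^ (2 * n) = (((1 - (q : ℝ) ^ 2) * (q : ℝ) ^ (2 * n) : ℝ) : ℂ) := by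
    simp [cq]
  rw [h, ← Complex.ofReal_mul, Complex.ofReal_re]
  have := qsq_lt q
  have := q_pos q
  have : 0 ≤ 1 - (q : ℝ) ^ 2 := by linarith
  positivity

/-! ### The Hilbert space completion -/

/-- The coordinate algebra, regarded as a space with the inner product `⟨y, x⟩ = h(x y*)`. -/
def PreL2 (q : Param) : Type := Coord q

instance (q : Param) : AddCommGroup (PreL2 q) := inferInstanceAs (AddCommGroup (Coord q))
instance (q : Param) : Module ℂ (PreL2 q) := inferInstanceAs (Module ℂ (Coord q))

/-- The identity map from the coordinate algebra to the same space with its inner product. -/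
def toPreL2 (q : Param) : Coord q ≃ₗ[ℂ] PreL2 q := LinearEquiv.refl ℂ (Coord q)

/-- The inner product `⟨y, x⟩ = h(x y*)`, conjugate-linear in the first variable. -/
instance (q : Param) : PreInnerProductSpace.Core ℂ (PreL2 q) where
  inner y x := haar q ((toPreL2 q).symm x * star ((toPreL2 q).symm y))
  conj_inner_symm x y := haar_conj q _ _
  re_inner_nonneg x := haar_nonneg q _
  add_left x y z := by rw [map_add, star_add, mul_add, map_add]
  smul_left x y r := by rw [map_smul, star_smul, mul_smul_comm, map_smul, smul_eq_mul]; rfl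

instance (q : Param) : SeminormedAddCommGroup (PreL2 q) :=
  InnerProductSpace.Core.toSeminormedAddCommGroup (𝕜 := ℂ)

instance (q : Param) : InnerProductSpace ℂ (PreL2 q) := InnerProductSpace.ofCore inferInstance

/-- The Gelfand–Naimark–Segal Hilbert space `L²(SU_q(2))`: the completion of the coordinate
algebra for the norm `‖f‖ = h(f f*)^{1/2}`. -/
abbrev L2 (q : Param) : Type := UniformSpace.Completion (PreL2 q)

/-- The canonical map from the coordinate algebra to the Hilbert space. -/
def toL2 (q : Param) : Coord q →ₗ[ℂ] L2 q :=
  (UniformSpace.Completion.toComplL (𝕜 := ℂ) (E := PreL2 q)).toLinearMap.comp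
    (toPreL2 q).toLinearMap

theorem inner_toL2 (q : Param) (x y : Coord q) :
    inner ℂ (toL2 q y) (toL2 q x) = haar q (x * star y) :=
  UniformSpace.Completion.inner_coe (𝕜 := ℂ) (toPreL2 q y) (toPreL2 q x)


/-! ### The coproduct and invariance of the Haar functional -/

/-- The values of the coproduct on generators. -/
def comulGen (q : Param) : Gen → Coord q ⊗[ℂ] Coord q
  | .a => gen q .a ⊗ₜ gen q .a + gen q .b ⊗ₜ gen q .c
  | .b => gen q .a ⊗ₜ gen q .b + gen q .b ⊗ₜ gen q .d
  | .c => gen q .c ⊗ₜ gen q .a + gen q .d ⊗ₜ gen q .c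
  | .d => gen q .c ⊗ₜ gen q .b + gen q .d ⊗ₜ gen q .d

theorem isQuad_comul (q : Param) : IsQuad q (comulGen q) := by
  have h := isQuad_gen q
  have hq := cq_ne q
  constructor <;>
    simp only [comulGen, add_mul, mul_add, Algebra.TensorProduct.tmul_mul_tmul, ← h.bc, h.ad,
      h.da, h.ab, h.ac, h.bd, h.cd, TensorProduct.add_tmul, TensorProduct.tmul_add,
      TensorProduct.tmul_smul, ← TensorProduct.smul_tmul', Algebra.TensorProduct.one_def] <;>
    match_scalars <;> field_simp

/-- The coproduct. -/
def comul (q : Param) : Coord q →ₐ[ℂ] Coord q ⊗[ℂ] Coord q := lift q _ (isQuad_comul q)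

/-- A (normalized) Haar functional: `(id ⊗ h) Δ(f) = h(f) 1 = (h ⊗ id) Δ(f)` and `h(1) = 1`. -/
structure IsHaar (q : Param) (h : Coord q →ₗ[ℂ] ℂ) : Prop where
  one : h 1 = 1
  right (f : Coord q) : TensorProduct.rid ℂ (Coord q) (h.lTensor (Coord q) (comul q f)) = h f • 1
  left (f : Coord q) : TensorProduct.lid ℂ (Coord q) (h.rTensor (Coord q) (comul q f)) = h f • 1


theorem wshift_apply {s : ℕ × ℤ → ℕ × ℤ} (hs : Function.Injective s) (w : ℕ × ℤ → ℂ) (v : Fock)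
    (p : ℕ × ℤ) : wshift s w v (s p) = w p * v p := by
  induction v using Finsupp.induction_linear with
  | zero => simp
  | add u v hu hv => rw [map_add, Finsupp.add_apply, hu, hv, Finsupp.add_apply, mul_add]
  | single r z =>
    rw [wshift_single]
    by_cases h : r = p
    · subst h; simp [mul_comm]
    · rw [Finsupp.single_eq_of_ne (fun h' => h (hs h'.symm)), Finsupp.single_eq_of_ne (Ne.symm h),
        mul_zero]

theorem wshift_apply_of_notMem {s : ℕ × ℤ → ℕ × ℤ} (w : ℕ × ℤ → ℂ) (v : Fock)
    {r : ℕ × ℤ} (hr : ∀ p, s p ≠ r) : wshift s w v r = 0 := by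
  induction v using Finsupp.induction_linear with
  | zero => simp
  | add u v hu hv => rw [map_add, Finsupp.add_apply, hu, hv, add_zero]
  | single p z => rw [wshift_single, Finsupp.single_eq_of_ne (hr p).symm]

/-- Two homomorphisms that agree on generators up to an intertwiner are intertwined. -/
theorem intertwine {q : Param} (φ : Coord q →ₐ[ℂ] Coord q) (D : Module.End ℂ Fock)
    (hg : ∀ g, rep q (φ (gen q g)) * D = D * rep q (gen q g)) (x : Coord q) :
    rep q (φ x) * D = D * rep q x := by
  induction x using coord_induction with
  | hs z => rw [AlgHom.commutes, AlgHom.commutes, Algebra.commutes]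
  | hg g => exact hg g
  | hadd x y hx hy => rw [map_add, map_add, map_add, add_mul, mul_add, hx, hy]
  | hmul x y hx hy => rw [map_mul, map_mul, map_mul, mul_assoc, hy, ← mul_assoc, hx, mul_assoc]

theorem rep_gen (q : Param) (g : Gen) : rep q (gen q g) = repGen q g := lift_gen _ _ _ _

/-- The skew derivation used to prove invariance, as a homomorphism to upper triangular
matrices. -/
def skewGen (q : Param) : Gen → Matrix (Fin 2) (Fin 2) (Coord q)
  | .a => !![cq q • gen q .a, gen q .c; 0, gen q .a]
  | .b => !![cq q • gen q .b, gen q .d; 0, gen q .b]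
  | .c => !![(cq q)⁻¹ • gen q .c, 0; 0, gen q .c]
  | .d => !![(cq q)⁻¹ • gen q .d, 0; 0, gen q .d]

theorem isQuad_skew (q : Param) : IsQuad q (skewGen q) := by
  have h := isQuad_gen q
  have hq := cq_ne q
  constructor <;>
    (ext i j
     fin_cases i <;> fin_cases j <;>
     simp [skewGen, Matrix.mul_apply, Fin.sum_univ_two, Matrix.one_apply, smul_smul, ← h.bc, h.ad,
      h.da, h.ab, h.ac, h.bd, h.cd, hq]) <;>
    try (match_scalars <;> field_simp)

def skew (q : Param) : Coord q →ₐ[ℂ] Matrix (Fin 2) (Fin 2) (Coord q) := lift q _ (isQuad_skew q)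

/-- The automorphism scaling the rows of the generating matrix. -/
def kapGen (q : Param) : Gen → Coord q
  | .a => cq q • gen q .a
  | .b => cq q • gen q .b
  | .c => (cq q)⁻¹ • gen q .c
  | .d => (cq q)⁻¹ • gen q .d

theorem isQuad_kap (q : Param) : IsQuad q (kapGen q) := by
  have h := isQuad_gen q
  have hq := cq_ne q
  constructor <;>
    simp only [kapGen, smul_mul_assoc, mul_smul_comm, smul_smul, ← h.bc, h.ad,
      h.da, h.ab, h.ac, h.bd, h.cd] <;>
    match_scalars <;> field_simp

def kap (q : Param) : Coord q →ₐ[ℂ] Coord q := lift q _ (isQuad_kap q)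

theorem kap_gen (q : Param) (g : Gen) : kap q (gen q g) = kapGen q g := lift_gen _ _ _ _

theorem skew_form (q : Param) (x : Coord q) :
    skew q x 0 0 = kap q x ∧ skew q x 1 0 = 0 ∧ skew q x 1 1 = x := by
  induction x using coord_induction with
  | hs z => simp [AlgHom.commutes, Matrix.algebraMap_matrix_apply]
  | hg g => rw [skew, lift_gen, kap_gen]; cases g <;> simp [skewGen, kapGen]
  | hadd x y hx hy => simp [hx, hy]
  | hmul x y hx hy => simp [Matrix.mul_apply, Fin.sum_univ_two, hx, hy]

/-- The skew derivation with `∂ a = c`, `∂ b = d`, `∂ c = ∂ d = 0`. -/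
def der (q : Param) : Coord q →ₗ[ℂ] Coord q where
  toFun x := skew q x 0 1
  map_add' x y := by simp
  map_smul' z x := by simp

theorem der_mul (q : Param) (x y : Coord q) :
    der q (x * y) = kap q x * der q y + der q x * y := by
  have h := skew_form q
  simp [der, Matrix.mul_apply, Fin.sum_univ_two, h]

/-- The values of the skew derivation on generators. -/
def derGen (q : Param) : Gen → Coord q
  | .a => gen q .c
  | .b => gen q .d
  | .c => 0
  | .d => 0

theorem der_gen (q : Param) (g : Gen) : der q (gen q g) = derGen q g := by
  cases g <;> simp [der, skew, skewGen, derGen]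

theorem der_algebraMap (q : Param) (z : ℂ) : der q (algebraMap ℂ _ z) = 0 := by
  simp [der, AlgHom.commutes, Matrix.algebraMap_matrix_apply]

/-- The diagonal operator `e_{n,k} ↦ q^{-n-k} e_{n,k}`. -/
def diagOp (q : Param) : Module.End ℂ Fock := wshift id (fun p => cq q ^ (-(p.1 : ℤ) - p.2))

theorem rep_kap (q : Param) (x : Coord q) : rep q (kap q x) * diagOp q = diagOp q * rep q x := by
  have hq := cq_ne q
  refine intertwine _ _ (fun g => ?_) x
  rw [kap_gen]
  apply end_ext
  rintro ⟨n, k⟩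
  cases g <;>
    simp only [kapGen, map_smul, rep_gen, repGen, diagOp, Module.End.mul_apply, wshift_single,
      LinearMap.smul_apply, Finsupp.smul_single, smul_eq_mul, one_mul, id]
  · cases n with
    | zero => simp [sq_zero]
    | succ n =>
      congr 1
      have e : (-((n + 1 : ℕ) : ℤ) - k) = -((n + 1 - 1 : ℕ) : ℤ) - k - 1 := by
        rw [Nat.add_sub_cancel]; push_cast; ring
      rw [e, zpow_sub_one₀ hq]
      field_simp
  · congr 1
    have e : (-(n : ℤ) - (k - 1)) = -(n : ℤ) - k + 1 := by ring
    rw [e, zpow_add_one₀ hq]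
    ring
  · congr 1
    have e : (-(n : ℤ) - (k + 1)) = -(n : ℤ) - k - 1 := by ring
    rw [e, zpow_sub_one₀ hq]
    ring
  · congr 1
    have e : (-((n + 1 : ℕ) : ℤ) - k) = -(n : ℤ) - k - 1 := by push_cast; ring
    rw [e, zpow_sub_one₀ hq]
    ring

theorem rep_kap_apply (q : Param) (x : Coord q) (p r : ℕ × ℤ) :
    cq q ^ (-(r.1 : ℤ) - r.2) * rep q (kap q x) (basisVec r) p =
      cq q ^ (-(p.1 : ℤ) - p.2) * rep q x (basisVec r) p := by
  have h := DFunLike.congr_fun (DFunLike.congr_fun (rep_kap q x) (basisVec r)) p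
  have e : diagOp q (basisVec r) = cq q ^ (-(r.1 : ℤ) - r.2) • basisVec r := by
    simp [diagOp]
  rw [Module.End.mul_apply, Module.End.mul_apply, e, map_smul, Finsupp.smul_apply, smul_eq_mul,
    diagOp] at h
  rw [h]
  exact wshift_apply (s := id) Function.injective_id _ _ p

theorem haar_kap (q : Param) (x : Coord q) : haar q (kap q x) = haar q x := by
  rw [haar_apply, haar_apply]
  congr 1
  ext n
  rw [haarTerm, haarTerm]
  congr 1
  have h := rep_kap_apply q x (n, 0) (n, 0)
  exact mul_left_cancel₀ (zpow_ne_zero _ (cq_ne q)) h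

theorem rep_translate (q : Param) (x : Coord q) :
    rep q x * wshift (fun p => (p.1, p.2 + 1)) (fun _ => 1) =
      wshift (fun p => (p.1, p.2 + 1)) (fun _ => 1) * rep q x := by
  refine intertwine (AlgHom.id ℂ _) _ (fun g => ?_) x
  rw [AlgHom.id_apply]
  apply end_ext
  rintro ⟨n, k⟩
  cases g <;> simp [rep_gen, repGen]

theorem rep_translate_apply (q : Param) (x : Coord q) (n m : ℕ) (k l : ℤ) :
    rep q x (basisVec (n, k + 1)) (m, l + 1) = rep q x (basisVec (n, k)) (m, l) := by
  have h := DFunLike.congr_fun (DFunLike.congr_fun (rep_translate q x) (basisVec (n, k))) (m, l + 1)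
  rw [Module.End.mul_apply, Module.End.mul_apply, wshift_single, one_mul] at h
  rw [h]
  have h2 := wshift_apply (s := fun p : ℕ × ℤ => (p.1, p.2 + 1))
    (fun p r h => by simpa [Prod.ext_iff] using h) (fun _ => 1) (rep q x (basisVec (n, k))) (m, l)
  rw [one_mul] at h2
  exact h2

/-- The weights of the operator implementing the skew derivation. -/
def yw (q : Param) (n : ℕ) : ℂ := -(cq q ^ (n + 1))⁻¹ * sq q (n + 1) * (1 - cq q ^ 2)⁻¹

theorem one_sub_ne (q : Param) (n : ℕ) (hn : n ≠ 0) : 1 - cq q ^ n ≠ 0 := by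
  have h : (q : ℝ) ^ n < 1 := pow_lt_one₀ (q_pos q).le (q_lt q) hn
  rw [sub_ne_zero]
  unfold cq
  intro h'
  have : (q : ℝ) ^ n = 1 := by exact_mod_cast h'.symm
  linarith

/-- The (unbounded) operator implementing the skew derivation. -/
def yOp (q : Param) : Module.End ℂ Fock := wshift (fun p => (p.1 + 1, p.2 + 1)) (fun p => yw q p.1)

theorem rep_der (q : Param) (x : Coord q) :
    rep q (der q x) + rep q (kap q x) * yOp q = yOp q * rep q x := by
  have hq := cq_ne q
  have h2 := one_sub_ne q 2 two_ne_zero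
  induction x using coord_induction with
  | hs z => rw [der_algebraMap, map_zero, AlgHom.commutes, AlgHom.commutes, zero_add,
      Algebra.commutes]
  | hg g =>
    rw [der_gen, kap_gen]
    apply end_ext
    rintro ⟨n, k⟩
    cases g <;>
      simp only [derGen, kapGen, map_smul, map_zero, rep_gen, repGen, yOp, Module.End.mul_apply,
        wshift_single, LinearMap.add_apply, LinearMap.zero_apply, zero_add, add_sub_cancel_right,
        sub_add_cancel, Nat.add_sub_cancel,
        LinearMap.smul_apply, Finsupp.smul_single, smul_eq_mul, one_mul]
    · cases n with
      | zero =>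
        rw [← Finsupp.single_add, sq_zero, zero_mul, Finsupp.single_zero, Finsupp.single_eq_zero]
        have e := sq_mul_self q (0 + 1)
        simp only [yw]
        field_simp
        linear_combination (-cq q) * e
      | succ n =>
        rw [Nat.add_sub_cancel, ← Finsupp.single_add]
        congr 1
        have e := sq_mul_self q (n + 1)
        have e' := sq_mul_self q (n + 1 + 1)
        simp only [yw]
        field_simp
        linear_combination cq q ^ (n + 2) * (e - e')
    · rw [← Finsupp.single_add]
      congr 1
      simp only [yw]
      field_simp
      ring
    · congr 1
      simp only [yw]
      field_simp
      ring
    · congr 1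
      simp only [yw]
      field_simp
      ring
  | hadd x y hx hy =>
    simp only [map_add, mul_add, add_mul, ← hx, ← hy]
    abel
  | hmul x y hx hy =>
    rw [der_mul, map_add, map_mul, map_mul, map_mul, map_mul, map_mul, ← mul_assoc, ← hx, add_mul,
      mul_assoc _ (yOp q), ← hy, mul_add, ← mul_assoc]
    abel

theorem norm_yw_mul (q : Param) (n : ℕ) : ‖cq q ^ (n + 1) * yw q n‖ ≤ ‖(1 - cq q ^ 2)⁻¹‖ := by
  have hq := cq_ne q
  have e : cq q ^ (n + 1) * yw q n = -(sq q (n + 1) * (1 - cq q ^ 2)⁻¹) := by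
    simp only [yw]; field_simp
  rw [e, norm_neg, norm_mul]
  refine mul_le_of_le_one_left (norm_nonneg _) ?_
  rw [sq, Complex.norm_real, Real.norm_eq_abs, abs_of_nonneg (Real.sqrt_nonneg _),
    Real.sqrt_le_one]
  linarith [pow_pos (q_pos q) (2 * (n + 1))]

theorem haarTerm_der (q : Param) (x : Coord q) (N : ℕ) :
    ∑ n ∈ Finset.range (N + 1), haarTerm q (der q x) n =
      -((1 - cq q ^ 2) * cq q ^ (2 * N + 2) * yw q N * rep q x (basisVec (N + 1, 1)) (N, 0)) := by
  have hq := cq_ne q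
  have key : ∀ n, rep q (der q x) (basisVec (n, 0)) (n, 0) =
      yOp q (rep q x (basisVec (n, 0))) (n, 0) -
        cq q ^ 2 * yw q n * rep q x (basisVec (n + 1, 1)) (n, 0) := by
    intro n
    have h := DFunLike.congr_fun (DFunLike.congr_fun (rep_der q x) (basisVec (n, 0))) (n, 0)
    rw [LinearMap.add_apply, Module.End.mul_apply, Module.End.mul_apply, Finsupp.add_apply] at h
    rw [← h]
    have e : yOp q (basisVec (n, 0)) = yw q n • basisVec (n + 1, 1) := by simp [yOp]
    rw [e, map_smul, Finsupp.smul_apply, smul_eq_mul]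
    have h2 := rep_kap_apply q x (n, 0) (n + 1, 1)
    have e2 : (-((n + 1 : ℕ) : ℤ) - 1) = -(n : ℤ) - 0 - 1 - 1 := by push_cast; ring
    rw [e2, zpow_sub_one₀ hq, zpow_sub_one₀ hq] at h2
    have hz := zpow_ne_zero (-(n : ℤ) - 0) hq
    have h3 : rep q (kap q x) (basisVec (n + 1, 1)) (n, 0) =
        cq q ^ 2 * rep q x (basisVec (n + 1, 1)) (n, 0) := by
      field_simp at h2
      exact h2
    rw [h3]
    ring
  induction N with
  | zero =>
    rw [zero_add, Finset.sum_range_one, haarTerm, key]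
    have : yOp q (rep q x (basisVec (0, 0))) (0, 0) = 0 :=
      wshift_apply_of_notMem _ _ (fun p h => by simp [Prod.ext_iff] at h)
    rw [this]
    ring
  | succ N ih =>
    rw [Finset.sum_range_succ, ih, haarTerm, key]
    have h1 : yOp q (rep q x (basisVec (N + 1, 0))) (N + 1, 0) =
        yw q N * rep q x (basisVec (N + 1, 0)) (N, -1) :=
      wshift_apply (s := fun p : ℕ × ℤ => (p.1 + 1, p.2 + 1))
        (fun p r h => by simpa [Prod.ext_iff] using h) _ _ (N, -1)
    have h2 := rep_translate_apply q x (N + 1) N 0 (-1)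
    rw [zero_add, neg_add_cancel] at h2
    rw [h1, ← h2]
    ring

theorem haar_der (q : Param) (x : Coord q) : haar q (der q x) = 0 := by
  have h1 := (summable_haarTerm q (der q x)).hasSum.tendsto_sum_nat.comp
    (Filter.tendsto_add_atTop_nat 1)
  rw [haar_apply]
  refine tendsto_nhds_unique h1 ?_
  obtain ⟨C, hC, h⟩ := rep_bounded q x
  have hb : ∀ N : ℕ, ‖∑ n ∈ Finset.range (N + 1), haarTerm q (der q x) n‖ ≤
      (‖(1 - cq q ^ 2)‖ * ‖(1 - cq q ^ 2)⁻¹‖ * C) * (q : ℝ) ^ (N + 1) := by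
    intro N
    rw [haarTerm_der, norm_neg]
    have e : (1 - cq q ^ 2) * cq q ^ (2 * N + 2) * yw q N *
        rep q x (basisVec (N + 1, 1)) (N, 0) = (1 - cq q ^ 2) * (cq q ^ (N + 1) * yw q N) *
        rep q x (basisVec (N + 1, 1)) (N, 0) * cq q ^ (N + 1) := by ring
    rw [e, norm_mul, norm_mul, norm_mul, norm_pow, norm_cq]
    refine mul_le_mul_of_nonneg_right ?_ (pow_nonneg (q_pos q).le _)
    refine mul_le_mul (mul_le_mul_of_nonneg_left (norm_yw_mul q N) (norm_nonneg _)) ?_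
      (norm_nonneg _) (by positivity)
    refine (norm_le_normOne _ _).trans ((h _).trans ?_)
    rw [normOne_single, norm_one, mul_one]
  have h0 : Filter.Tendsto (fun N : ℕ => (‖(1 - cq q ^ 2)‖ * ‖(1 - cq q ^ 2)⁻¹‖ * C) *
      (q : ℝ) ^ (N + 1)) Filter.atTop (nhds 0) := by
    have := ((tendsto_pow_atTop_nhds_zero_of_lt_one (q_pos q).le (q_lt q)).comp
      (Filter.tendsto_add_atTop_nat 1)).const_mul (‖(1 - cq q ^ 2)‖ * ‖(1 - cq q ^ 2)⁻¹‖ * C)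
    rwa [mul_zero] at this
  exact squeeze_zero_norm hb h0

theorem haar_one (q : Param) : haar q 1 = 1 := by
  have h2 := one_sub_ne q 2 two_ne_zero
  have h : HasSum (fun n : ℕ => (1 - cq q ^ 2) * (cq q ^ 2) ^ n) ((1 - cq q ^ 2) * (1 - cq q ^ 2)⁻¹) := by
    have h0 : ‖cq q ^ 2‖ < 1 := by
      rw [norm_pow, norm_cq]
      exact qsq_lt q
    have h3 := hasSum_geometric_of_norm_lt_one h0
    exact h3.mul_left (1 - cq q ^ 2)
  rw [mul_inv_cancel₀ h2] at h
  rw [haar_apply, ← h.tsum_eq]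
  congr 1
  ext n
  simp [haarTerm, pow_mul]

/-- The convolution `(h ⊗ id) Δ`. -/
def convLeft (q : Param) : Coord q →ₗ[ℂ] Coord q :=
  (TensorProduct.lid ℂ (Coord q)).toLinearMap ∘ₗ
    (haar q).rTensor (Coord q) ∘ₗ (comul q).toLinearMap

theorem comul_gen (q : Param) (g : Gen) : comul q (gen q g) = comulGen q g := lift_gen _ _ _ _

theorem comul_kap (q : Param) (x : Coord q) :
    comul q (kap q x) = (kap q).toLinearMap.rTensor (Coord q) (comul q x) := by
  have e : ∀ y, (kap q).toLinearMap.rTensor (Coord q) y =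
    Algebra.TensorProduct.map (kap q) (AlgHom.id ℂ (Coord q)) y := fun y => rfl
  rw [e]
  induction x using coord_induction with
  | hs z => simp only [AlgHom.commutes]
  | hg g =>
    rw [kap_gen, comul_gen]
    cases g <;> simp [kapGen, comulGen, comul_gen, kap_gen, TensorProduct.smul_tmul', smul_add]
  | hadd x y hx hy => simp only [map_add, hx, hy]
  | hmul x y hx hy => simp only [map_mul, hx, hy]

theorem der_rTensor_mul (q : Param) (X Y : Coord q ⊗[ℂ] Coord q) :
    (der q).rTensor (Coord q) (X * Y) = (kap q).toLinearMap.rTensor (Coord q) X *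
      (der q).rTensor (Coord q) Y + (der q).rTensor (Coord q) X * Y := by
  induction X using TensorProduct.induction_on with
  | zero => simp
  | add X X' hX hX' => rw [add_mul, map_add, hX, hX', map_add, map_add, add_mul, add_mul]; abel
  | tmul x x' =>
    induction Y using TensorProduct.induction_on with
    | zero => simp
    | add Y Y' hY hY' => rw [mul_add, map_add, hY, hY', map_add, mul_add, mul_add]; abel
    | tmul y y' =>
      simp [Algebra.TensorProduct.tmul_mul_tmul, der_mul, TensorProduct.add_tmul]

theorem comul_der (q : Param) (x : Coord q) :
    comul q (der q x) = (der q).rTensor (Coord q) (comul q x) := by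
  induction x using coord_induction with
  | hs z =>
    rw [der_algebraMap, map_zero, AlgHom.commutes, Algebra.TensorProduct.algebraMap_apply,
      LinearMap.rTensor_tmul, der_algebraMap, TensorProduct.zero_tmul]
  | hg g =>
    rw [der_gen, comul_gen]
    cases g <;> simp [derGen, comulGen, comul_gen, der_gen]
  | hadd x y hx hy => simp only [map_add, hx, hy]
  | hmul x y hx hy =>
    rw [der_mul, map_add, map_mul, map_mul, map_mul, hx, hy, comul_kap, der_rTensor_mul]

/-- The subspace on which left invariance holds. -/
def invSpace (q : Param) : Submodule ℂ (Coord q) :=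
  LinearMap.eqLocus (convLeft q) ((haar q).smulRight 1)

theorem mem_invSpace (q : Param) (x : Coord q) :
    x ∈ invSpace q ↔ convLeft q x = haar q x • 1 := Iff.rfl

theorem der_mem (q : Param) (x : Coord q) : der q x ∈ invSpace q := by
  rw [mem_invSpace, haar_der, zero_smul]
  have h : (haar q) ∘ₗ der q = 0 := LinearMap.ext (haar_der q)
  simp only [convLeft, LinearMap.comp_apply, AlgHom.toLinearMap_apply, comul_der]
  rw [← LinearMap.rTensor_comp_apply, h]
  simp

theorem kap_sub_mem (q : Param) (x : Coord q) : kap q x - x ∈ invSpace q := by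
  rw [mem_invSpace, map_sub, map_sub, haar_kap, sub_self, zero_smul]
  have h : (haar q) ∘ₗ (kap q).toLinearMap = haar q := LinearMap.ext (haar_kap q)
  simp only [convLeft, LinearMap.comp_apply, AlgHom.toLinearMap_apply, comul_kap]
  rw [← LinearMap.rTensor_comp_apply, h, sub_self]

theorem one_mem (q : Param) : 1 ∈ invSpace q := by
  rw [mem_invSpace, haar_one]
  simp [convLeft, haar_one, Algebra.TensorProduct.one_def]

theorem b_mul_a_pow (q : Param) (n : ℕ) :
    gen q .a ^ n * gen q .b = cq q ^ n • (gen q .b * gen q .a ^ n) := by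
  induction n with
  | zero => simp
  | succ n ih =>
    rw [pow_succ', mul_assoc, ih, mul_smul_comm, ← mul_assoc, (isQuad_gen q).ab, smul_mul_assoc,
      smul_smul, mul_assoc, pow_succ]

theorem c_mul_a_pow (q : Param) (n : ℕ) :
    gen q .a ^ n * gen q .c = cq q ^ n • (gen q .c * gen q .a ^ n) := by
  induction n with
  | zero => simp
  | succ n ih =>
    rw [pow_succ', mul_assoc, ih, mul_smul_comm, ← mul_assoc, (isQuad_gen q).ac, smul_mul_assoc,
      smul_smul, mul_assoc, pow_succ]

theorem b_mul_d_pow (q : Param) (n : ℕ) :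
    gen q .b * gen q .d ^ n = cq q ^ n • (gen q .d ^ n * gen q .b) := by
  induction n with
  | zero => simp
  | succ n ih =>
    rw [pow_succ, ← mul_assoc, ih, smul_mul_assoc, mul_assoc, (isQuad_gen q).bd, mul_smul_comm,
      smul_smul, mul_assoc, pow_succ]

theorem c_mul_d_pow (q : Param) (n : ℕ) :
    gen q .c * gen q .d ^ n = cq q ^ n • (gen q .d ^ n * gen q .c) := by
  induction n with
  | zero => simp
  | succ n ih =>
    rw [pow_succ, ← mul_assoc, ih, smul_mul_assoc, mul_assoc, (isQuad_gen q).cd, mul_smul_comm,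
      smul_smul, mul_assoc, pow_succ]

theorem b_pow_mul_d (q : Param) (n : ℕ) :
    gen q .b ^ n * gen q .d = cq q ^ n • (gen q .d * gen q .b ^ n) := by
  induction n with
  | zero => simp
  | succ n ih =>
    rw [pow_succ', mul_assoc, ih, mul_smul_comm, ← mul_assoc, (isQuad_gen q).bd, smul_mul_assoc,
      smul_smul, mul_assoc, pow_succ]

theorem c_mul_b_pow (q : Param) (n : ℕ) :
    gen q .c * gen q .b ^ n = gen q .b ^ n * gen q .c :=
  (Commute.pow_right (show Commute (gen q .c) (gen q .b) from (isQuad_gen q).bc.symm) n)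

/-- The ordered monomials `a^i b^j c^k`. -/
def monA (q : Param) (i j k : ℕ) : Coord q := gen q .a ^ i * (gen q .b ^ j * gen q .c ^ k)

/-- The ordered monomials `d^i b^j c^k`. -/
def monD (q : Param) (i j k : ℕ) : Coord q := gen q .d ^ i * (gen q .b ^ j * gen q .c ^ k)

theorem b_mul_bc (q : Param) (j k : ℕ) :
    gen q .b * (gen q .b ^ j * gen q .c ^ k) = gen q .b ^ (j + 1) * gen q .c ^ k := by
  rw [← mul_assoc, ← pow_succ']

theorem c_mul_bc (q : Param) (j k : ℕ) :
    gen q .c * (gen q .b ^ j * gen q .c ^ k) = gen q .b ^ j * gen q .c ^ (k + 1) := by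
  rw [← mul_assoc, c_mul_b_pow, mul_assoc, ← pow_succ']

theorem bcx (q : Param) (j k : ℕ) : gen q .b * gen q .c * (gen q .b ^ j * gen q .c ^ k) =
    gen q .b ^ (j + 1) * gen q .c ^ (k + 1) := by rw [mul_assoc, c_mul_bc, b_mul_bc]

theorem a_mul_monD (q : Param) (i j k : ℕ) : gen q .a * monD q (i + 1) j k =
    monD q i j k + (cq q * (cq q ^ i * cq q ^ i)) • monD q i (j + 1) (k + 1) := by
  rw [monD, pow_succ', mul_assoc, ← mul_assoc (gen q .a), (isQuad_gen q).ad, add_mul, one_mul,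
    smul_mul_assoc, mul_assoc (gen q .b) (gen q .c), ← mul_assoc (gen q .c) (gen q .d ^ i), c_mul_d_pow,
    smul_mul_assoc, mul_smul_comm, mul_assoc (gen q .d ^ i) (gen q .c), c_mul_bc,
    ← mul_assoc (gen q .b) (gen q .d ^ i), b_mul_d_pow, smul_mul_assoc, mul_assoc (gen q .d ^ i) (gen q .b), b_mul_bc,
    smul_smul, smul_smul, mul_assoc (cq q)]
  rfl

theorem d_mul_monA (q : Param) (i j k : ℕ) : gen q .d * monA q (i + 1) j k =
    monA q i j k + ((cq q)⁻¹ * ((cq q ^ i)⁻¹ * (cq q ^ i)⁻¹)) • monA q i (j + 1) (k + 1) := by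
  have hq := pow_ne_zero i (cq_ne q)
  have hb : gen q .b * gen q .a ^ i = (cq q ^ i)⁻¹ • (gen q .a ^ i * gen q .b) := by
    rw [b_mul_a_pow, smul_smul, inv_mul_cancel₀ hq, one_smul]
  have hc : gen q .c * gen q .a ^ i = (cq q ^ i)⁻¹ • (gen q .a ^ i * gen q .c) := by
    rw [c_mul_a_pow, smul_smul, inv_mul_cancel₀ hq, one_smul]
  rw [monA, pow_succ', mul_assoc, ← mul_assoc (gen q .d), (isQuad_gen q).da, add_mul, one_mul,
    smul_mul_assoc, mul_assoc (gen q .b) (gen q .c), ← mul_assoc (gen q .c) (gen q .a ^ i), hc,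
    smul_mul_assoc, mul_smul_comm, mul_assoc (gen q .a ^ i) (gen q .c), c_mul_bc,
    ← mul_assoc (gen q .b) (gen q .a ^ i), hb, smul_mul_assoc, mul_assoc (gen q .a ^ i) (gen q .b), b_mul_bc,
    smul_smul, smul_smul, mul_assoc (cq q)⁻¹]
  rfl

/-- The ordered monomials span the coordinate algebra. -/
theorem monomials_span (q : Param) (S : Submodule ℂ (Coord q)) (hA : ∀ i j k, monA q i j k ∈ S)
    (hD : ∀ i j k, monD q i j k ∈ S) (x : Coord q) : x ∈ S := by
  have hz : ∀ j k, monD q 0 j k = monA q 0 j k := fun j k => by simp [monA, monD]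
  have step : ∀ g, ∀ y, y ∈ Submodule.span ℂ
      (Set.range (fun p : ℕ × ℕ × ℕ => monA q p.1 p.2.1 p.2.2) ∪
        Set.range (fun p : ℕ × ℕ × ℕ => monD q p.1 p.2.1 p.2.2)) →
      gen q g * y ∈ Submodule.span ℂ
      (Set.range (fun p : ℕ × ℕ × ℕ => monA q p.1 p.2.1 p.2.2) ∪
        Set.range (fun p : ℕ × ℕ × ℕ => monD q p.1 p.2.1 p.2.2)) := by
    intro g y hy
    set M := Submodule.span ℂ
      (Set.range (fun p : ℕ × ℕ × ℕ => monA q p.1 p.2.1 p.2.2) ∪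
        Set.range (fun p : ℕ × ℕ × ℕ => monD q p.1 p.2.1 p.2.2)) with hM
    have mA : ∀ i j k, monA q i j k ∈ M := fun i j k =>
      Submodule.subset_span (Or.inl ⟨(i, j, k), rfl⟩)
    have mD : ∀ i j k, monD q i j k ∈ M := fun i j k =>
      Submodule.subset_span (Or.inr ⟨(i, j, k), rfl⟩)
    have e1 : ∀ i j k, gen q .a * monA q i j k = monA q (i + 1) j k := fun i j k => by
      rw [monA, ← mul_assoc, ← pow_succ', monA]
    have e2 : ∀ i j k, gen q .d * monD q i j k = monD q (i + 1) j k := fun i j k => by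
      rw [monD, ← mul_assoc, ← pow_succ', monD]
    have e3 : ∀ i j k, gen q .b * monD q i j k ∈ M := fun i j k => by
      rw [monD, ← mul_assoc, b_mul_d_pow, smul_mul_assoc, mul_assoc, b_mul_bc]
      exact M.smul_mem _ (mD _ _ _)
    have e4 : ∀ i j k, gen q .c * monD q i j k ∈ M := fun i j k => by
      rw [monD, ← mul_assoc, c_mul_d_pow, smul_mul_assoc, mul_assoc, c_mul_bc]
      exact M.smul_mem _ (mD _ _ _)
    have e5 : ∀ i j k, gen q .b * monA q i j k ∈ M := fun i j k => by
      have h := mA i (j + 1) k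
      rw [monA, ← b_mul_bc, ← mul_assoc, b_mul_a_pow, smul_mul_assoc, mul_assoc] at h
      exact (M.smul_mem_iff (pow_ne_zero i (cq_ne q))).mp h
    have e6 : ∀ i j k, gen q .c * monA q i j k ∈ M := fun i j k => by
      have h := mA i j (k + 1)
      rw [monA, ← c_mul_bc, ← mul_assoc, c_mul_a_pow, smul_mul_assoc, mul_assoc] at h
      exact (M.smul_mem_iff (pow_ne_zero i (cq_ne q))).mp h
    have e7 : ∀ i j k, gen q .a * monD q i j k ∈ M := fun i j k => by
      cases i with
      | zero => rw [hz, e1]; exact mA _ _ _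
      | succ i => rw [a_mul_monD]; exact M.add_mem (mD _ _ _) (M.smul_mem _ (mD _ _ _))
    have e8 : ∀ i j k, gen q .d * monA q i j k ∈ M := fun i j k => by
      cases i with
      | zero => rw [← hz, e2]; exact mD _ _ _
      | succ i => rw [d_mul_monA]; exact M.add_mem (mA _ _ _) (M.smul_mem _ (mA _ _ _))
    have hle : M ≤ M.comap (LinearMap.mulLeft ℂ (gen q g)) := by
      rw [hM, Submodule.span_le, ← hM]
      rintro _ (⟨⟨i, j, k⟩, rfl⟩ | ⟨⟨i, j, k⟩, rfl⟩) <;>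
        simp only [Submodule.comap_coe, Set.mem_preimage, LinearMap.mulLeft_apply, SetLike.mem_coe]
      · cases g
        · rw [e1]; exact mA _ _ _
        · exact e5 _ _ _
        · exact e6 _ _ _
        · exact e8 _ _ _
      · cases g
        · exact e7 _ _ _
        · exact e3 _ _ _
        · exact e4 _ _ _
        · rw [e2]; exact mD _ _ _
    exact hle hy
  have hall : ∀ x : Coord q, ∀ y, y ∈ Submodule.span ℂ
      (Set.range (fun p : ℕ × ℕ × ℕ => monA q p.1 p.2.1 p.2.2) ∪
        Set.range (fun p : ℕ × ℕ × ℕ => monD q p.1 p.2.1 p.2.2)) →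
      x * y ∈ Submodule.span ℂ
      (Set.range (fun p : ℕ × ℕ × ℕ => monA q p.1 p.2.1 p.2.2) ∪
        Set.range (fun p : ℕ × ℕ × ℕ => monD q p.1 p.2.1 p.2.2)) := by
    intro x
    induction x using coord_induction with
    | hs z => intro y hy; rw [← Algebra.smul_def]; exact Submodule.smul_mem _ _ hy
    | hg g => exact step g
    | hadd x y hx hy => intro w hw; rw [add_mul]; exact Submodule.add_mem _ (hx w hw) (hy w hw)
    | hmul x y hx hy => intro w hw; rw [mul_assoc]; exact hx _ (hy _ hw)
  have h1 : (1 : Coord q) = monA q 0 0 0 := by simp [monA]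
  have h := hall x 1 (by rw [h1]; exact Submodule.subset_span (Or.inl ⟨(0, 0, 0), rfl⟩))
  rw [mul_one] at h
  refine (Submodule.span_le.mpr ?_) h
  rintro _ (⟨⟨i, j, k⟩, rfl⟩ | ⟨⟨i, j, k⟩, rfl⟩)
  · exact hA _ _ _
  · exact hD _ _ _

theorem kap_monA (q : Param) (i j k : ℕ) : kap q (monA q i j k) =
    (cq q ^ i * (cq q ^ j * (cq q)⁻¹ ^ k)) • monA q i j k := by
  simp only [monA, map_mul, map_pow, kap_gen, kapGen, smul_pow, smul_mul_assoc, mul_smul_comm,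
    smul_smul]
  congr 1
  ring

theorem der_b_pow (q : Param) (n : ℕ) : der q (gen q .b ^ (n + 1)) =
    (∑ s ∈ Finset.range (n + 1), cq q ^ (2 * s)) • (gen q .d * gen q .b ^ n) := by
  induction n with
  | zero => simp [der_gen, derGen]
  | succ n ih =>
    rw [pow_succ', der_mul, ih, der_gen, kap_gen, kapGen, derGen, mul_smul_comm, smul_mul_assoc,
      smul_smul, ← mul_assoc, (isQuad_gen q).bd, smul_mul_assoc, smul_smul,
      mul_assoc (gen q .d) (gen q .b), ← pow_succ', Finset.sum_range_succ' _ (n + 1)]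
    have e : ∑ s ∈ Finset.range (n + 1), cq q ^ (2 * (s + 1)) =
        cq q ^ 2 * ∑ s ∈ Finset.range (n + 1), cq q ^ (2 * s) := by
      rw [Finset.mul_sum]
      exact Finset.sum_congr rfl fun s _ => by ring
    rw [e]
    module

theorem der_c_pow (q : Param) (n : ℕ) : der q (gen q .c ^ n) = 0 := by
  induction n with
  | zero => simpa using der_algebraMap q 1
  | succ n ih => rw [pow_succ', der_mul, ih, der_gen, derGen]; simp

theorem der_d_pow (q : Param) (n : ℕ) : der q (gen q .d ^ n) = 0 := by
  induction n with
  | zero => simpa using der_algebraMap q 1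
  | succ n ih => rw [pow_succ', der_mul, ih, der_gen, derGen]; simp

theorem der_a_pow (q : Param) (n : ℕ) : ∃ r : ℝ, 0 < r ∧
    der q (gen q .a ^ (n + 1)) = (r : ℂ) • (gen q .a ^ n * gen q .c) := by
  have hqp := q_pos q
  induction n with
  | zero => exact ⟨1, one_pos, by simp [der_gen, derGen]⟩
  | succ n ih =>
    obtain ⟨r, hr, ih⟩ := ih
    refine ⟨q * r + ((q : ℝ) ^ (n + 1))⁻¹, by positivity, ?_⟩
    have hc : gen q .c * gen q .a ^ (n + 1) =
        (cq q ^ (n + 1))⁻¹ • (gen q .a ^ (n + 1) * gen q .c) := by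
      rw [c_mul_a_pow, smul_smul, inv_mul_cancel₀ (pow_ne_zero _ (cq_ne q)), one_smul]
    rw [pow_succ', der_mul, ih, der_gen, kap_gen, kapGen, derGen, hc, mul_smul_comm,
      smul_mul_assoc, smul_smul, ← mul_assoc, ← pow_succ', ← add_smul]
    congr 1
    push_cast
    rw [mul_comm]
    rfl

theorem geom_pos (q : Param) (n : ℕ) : ∃ r : ℝ, 0 < r ∧
    ∑ s ∈ Finset.range (n + 1), cq q ^ (2 * s) = (r : ℂ) := by
  have hqp := q_pos q
  refine ⟨∑ s ∈ Finset.range (n + 1), (q : ℝ) ^ (2 * s),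
    Finset.sum_pos (fun _ _ => by positivity) ⟨0, by simp⟩, ?_⟩
  push_cast
  rfl

theorem monD_mem (q : Param) (i j k : ℕ) : monD q (i + 1) j k ∈ invSpace q := by
  obtain ⟨r, hr, e⟩ := geom_pos q j
  have h := der_mem q (gen q .d ^ i * (gen q .b ^ (j + 1) * gen q .c ^ k))
  rw [der_mul, der_d_pow, zero_mul, add_zero, der_mul, der_c_pow, mul_zero, zero_add, der_b_pow, e,
    map_pow, kap_gen, kapGen, smul_pow, smul_mul_assoc, smul_mul_assoc, mul_smul_comm,
    mul_assoc, ← mul_assoc, ← pow_succ] at h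
  rw [Submodule.smul_mem_iff _ (pow_ne_zero _ (inv_ne_zero (cq_ne q))),
    Submodule.smul_mem_iff _ (by exact_mod_cast hr.ne')] at h
  exact h

theorem monA_mem_of_ne (q : Param) (i j k : ℕ) (hk : i + j ≠ k) : monA q i j k ∈ invSpace q := by
  have hq := cq_ne q
  have h := kap_sub_mem q (monA q i j k)
  have e : ∀ z : ℂ, z • monA q i j k - monA q i j k = (z - 1) • monA q i j k := fun z => by
    rw [sub_smul, one_smul]
  rw [kap_monA, e] at h
  refine (Submodule.smul_mem_iff _ ?_).mp h
  rw [sub_ne_zero]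
  intro h'
  rw [← mul_assoc, ← pow_add, inv_pow, mul_inv_eq_one₀ (pow_ne_zero _ hq)] at h'
  have : (q : ℝ) ^ (i + j) = (q : ℝ) ^ k := by unfold cq at h'; exact_mod_cast h'
  exact hk (pow_right_injective₀ (q_pos q) (q_lt q).ne this)

theorem a_pow_mul_d (q : Param) (i j k : ℕ) :
    gen q .a ^ (i + 1) * (gen q .d * (gen q .b ^ j * gen q .c ^ k)) =
      monA q i j k + cq q • monA q i (j + 1) (k + 1) := by
  rw [pow_succ, mul_assoc, ← mul_assoc (gen q .a) (gen q .d), (isQuad_gen q).ad, add_mul, one_mul,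
    smul_mul_assoc, bcx, mul_add, mul_smul_comm]
  rfl

theorem monA_mem (q : Param) (i j : ℕ) : monA q i j (i + j) ∈ invSpace q := by
  have hqp := q_pos q
  induction j with
  | zero =>
    cases i with
    | zero => simpa [monA] using one_mem q
    | succ i =>
      obtain ⟨r, hr, e⟩ := der_a_pow q (i + 1)
      have h := der_mem q (gen q .a ^ (i + 1 + 1) * gen q .c ^ i)
      rw [der_mul, der_c_pow, mul_zero, zero_add, e, smul_mul_assoc, mul_assoc, ← pow_succ',
        Submodule.smul_mem_iff _ (by exact_mod_cast hr.ne')] at h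
      simpa [monA] using h
  | succ j ih =>
    obtain ⟨r, hr, e⟩ := der_a_pow q i
    obtain ⟨s, hs, e'⟩ := geom_pos q j
    have h := der_mem q (gen q .a ^ (i + 1) * (gen q .b ^ (j + 1) * gen q .c ^ (i + j)))
    have e3 : der q (gen q .a ^ (i + 1) * (gen q .b ^ (j + 1) * gen q .c ^ (i + j))) =
        ((r + q ^ (i + 1) * s * q : ℝ) : ℂ) • monA q i (j + 1) (i + (j + 1)) +
          (cq q ^ (i + 1) * s) • monA q i j (i + j) := by
      rw [der_mul, e, der_mul, der_c_pow, mul_zero, zero_add, der_b_pow, e', map_pow, kap_gen,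
        kapGen, smul_pow, smul_mul_assoc, smul_mul_assoc, mul_smul_comm, mul_assoc (gen q .d),
        a_pow_mul_d, smul_mul_assoc, mul_assoc (gen q .a ^ i), c_mul_bc, ← monA, ← add_assoc]
      have ec : cq q = ((q : ℝ) : ℂ) := rfl
      rw [ec]
      push_cast
      module
    rw [e3] at h
    have h2 := (Submodule.add_mem_iff_left _ (Submodule.smul_mem _ _ ih)).mp h
    refine (Submodule.smul_mem_iff _ ?_).mp h2
    have : 0 < r + q ^ (i + 1) * s * q := by positivity
    exact_mod_cast this.ne'

theorem convLeft_eq (q : Param) (x : Coord q) : convLeft q x = haar q x • 1 := by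
  rw [← mem_invSpace]
  refine monomials_span q _ (fun i j k => ?_) (fun i j k => ?_) x
  · by_cases h : i + j = k
    · subst h; exact monA_mem q i j
    · exact monA_mem_of_ne q i j k h
  · cases i with
    | succ i => exact monD_mem q i j k
    | zero =>
      have e : monD q 0 j k = monA q 0 j k := by simp [monA, monD]
      rw [e]
      by_cases h : 0 + j = k
      · subst h; exact monA_mem q 0 j
      · exact monA_mem_of_ne q 0 j k h

/-- The transposition automorphism, exchanging `b` and `c`. -/
def transGen (q : Param) : Gen → Coord q
  | .a => gen q .a
  | .b => gen q .c
  | .c => gen q .b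
  | .d => gen q .d

theorem isQuad_trans (q : Param) : IsQuad q (transGen q) := by
  have h := isQuad_gen q
  constructor <;> simp only [transGen, h.ab, h.ac, h.bd, h.cd, h.ad, h.da, h.bc]

def trans (q : Param) : Coord q →ₐ[ℂ] Coord q := lift q _ (isQuad_trans q)

theorem trans_gen (q : Param) (g : Gen) : trans q (gen q g) = transGen q g := lift_gen _ _ _ _

theorem trans_trans (q : Param) (x : Coord q) : trans q (trans q x) = x := by
  induction x using coord_induction with
  | hs z => simp only [AlgHom.commutes]
  | hg g => rw [trans_gen]; cases g <;> simp [transGen, trans_gen]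
  | hadd x y hx hy => simp only [map_add, hx, hy]
  | hmul x y hx hy => simp only [map_mul, hx, hy]

theorem haar_trans (q : Param) (x : Coord q) : haar q (trans q x) = haar q x := by
  have hq' := cq_ne q
  have hq : -cq q ≠ 0 := neg_ne_zero.mpr hq'
  have h := intertwine (trans q) (wshift (fun p => (p.1, -p.2)) (fun p => (-cq q) ^ p.2))
    (fun g => by
      rw [trans_gen]
      apply end_ext
      rintro ⟨n, k⟩
      cases g <;>
        simp only [transGen, rep_gen, repGen, Module.End.mul_apply, wshift_single, one_mul]
      · congr 1; ring
      · congr 1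
        · ext <;> simp; ring
        · rw [zpow_sub_one₀ hq]
          field_simp
          ring
      · congr 1
        · ext <;> simp; ring
        · rw [zpow_add_one₀ hq]
          ring
      · congr 1; ring) x
  rw [haar_apply, haar_apply]
  congr 1
  ext n
  rw [haarTerm, haarTerm]
  congr 1
  have h' := DFunLike.congr_fun (DFunLike.congr_fun h (basisVec (n, 0))) (n, 0)
  rw [Module.End.mul_apply, Module.End.mul_apply, wshift_single] at h'
  have h2 := wshift_apply (s := fun p : ℕ × ℤ => (p.1, -p.2))
    (fun p r h => by simpa [Prod.ext_iff] using h) (fun p => (-cq q) ^ p.2)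
    (rep q x (basisVec (n, 0))) (n, 0)
  simp only [neg_zero, zpow_zero, one_mul, mul_one] at h' h2
  rw [h', h2]

theorem comul_trans (q : Param) (x : Coord q) : comul q (trans q x) =
    Algebra.TensorProduct.comm ℂ (Coord q) (Coord q)
      (Algebra.TensorProduct.map (trans q) (trans q) (comul q x)) := by
  induction x using coord_induction with
  | hs z => simp only [AlgHom.commutes, AlgEquiv.commutes]
  | hg g =>
    rw [trans_gen, comul_gen]
    cases g <;> simp [transGen, comulGen, comul_gen, trans_gen]
  | hadd x y hx hy => simp only [map_add, hx, hy]
  | hmul x y hx hy => simp only [map_mul, hx, hy]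

/-- The explicit functional is a Haar functional. -/
theorem isHaar_haar (q : Param) : IsHaar q (haar q) where
  one := haar_one q
  left f := convLeft_eq q f
  right f := by
    have key : ∀ X : Coord q ⊗[ℂ] Coord q, TensorProduct.rid ℂ (Coord q)
        ((haar q).lTensor (Coord q) (Algebra.TensorProduct.comm ℂ (Coord q) (Coord q)
          (Algebra.TensorProduct.map (trans q) (trans q) X))) =
        trans q (TensorProduct.lid ℂ (Coord q) ((haar q).rTensor (Coord q) X)) := by
      intro X
      induction X using TensorProduct.induction_on with
      | zero => simp
      | add X Y hX hY => simp only [map_add, hX, hY]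
      | tmul x y => simp [haar_trans]
    have h1 := comul_trans q (trans q f)
    rw [trans_trans] at h1
    rw [h1, key, ← haar_trans q f]
    have h2 := convLeft_eq q (trans q f)
    change TensorProduct.lid ℂ (Coord q) ((haar q).rTensor (Coord q) (comul q (trans q f))) = _ at h2
    rw [h2, map_smul, map_one]

/-- A Haar functional is unique. -/
theorem IsHaar.unique {q : Param} {h h' : Coord q →ₗ[ℂ] ℂ} (H : IsHaar q h) (H' : IsHaar q h') :
    h = h' := by
  ext f
  have key : ∀ X : Coord q ⊗[ℂ] Coord q, h' (TensorProduct.lid ℂ (Coord q) (h.rTensor (Coord q) X))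
      = h (TensorProduct.rid ℂ (Coord q) (h'.lTensor (Coord q) X)) := by
    intro X
    induction X using TensorProduct.induction_on with
    | zero => simp
    | add X Y hX hY => simp only [map_add, hX, hY]
    | tmul x y => simp [mul_comm]
  have e := key (comul q f)
  rw [H.left, H'.right, map_smul, map_smul, H.one, H'.one] at e
  simpa using e

/-! ### The quantum plane and the irreducible corepresentations -/

/-- The relation `x y = q y x` of the quantum plane, with `x = ι 0` and `y = ι 1`. -/
inductive PlaneRel (q : Param) : FreeAlgebra ℂ (Fin 2) → FreeAlgebra ℂ (Fin 2) → Prop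
  | xy : PlaneRel q (FreeAlgebra.ι ℂ 0 * FreeAlgebra.ι ℂ 1)
      (cq q • (FreeAlgebra.ι ℂ 1 * FreeAlgebra.ι ℂ 0))

/-- The coordinate algebra of the quantum plane. -/
def Plane (q : Param) : Type := RingQuot (PlaneRel q)

instance (q : Param) : Ring (Plane q) := inferInstanceAs (Ring (RingQuot (PlaneRel q)))
instance (q : Param) : Algebra ℂ (Plane q) := inferInstanceAs (Algebra ℂ (RingQuot (PlaneRel q)))

/-- The generators `x` (index `0`) and `y` (index `1`) of the quantum plane. -/
def planeGen (q : Param) (i : Fin 2) : Plane q :=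
  RingQuot.mkAlgHom ℂ (PlaneRel q) (FreeAlgebra.ι ℂ i)

theorem plane_xy (q : Param) :
    planeGen q 0 * planeGen q 1 = cq q • (planeGen q 1 * planeGen q 0) := by
  have h := RingQuot.mkAlgHom_rel ℂ (PlaneRel.xy (q := q))
  simp only [map_mul, map_smul] at h
  exact h

/-- The universal property of the quantum plane. -/
def planeLift (q : Param) {B : Type*} [Ring B] [Algebra ℂ B] (f : Fin 2 → B)
    (hf : f 0 * f 1 = cq q • (f 1 * f 0)) : Plane q →ₐ[ℂ] B :=
  RingQuot.liftAlgHom ℂ ⟨FreeAlgebra.lift ℂ f, by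
    intro x y h
    induction h with
    | xy => simpa using hf⟩

theorem planeLift_gen (q : Param) {B : Type*} [Ring B] [Algebra ℂ B] (f : Fin 2 → B)
    (hf : f 0 * f 1 = cq q • (f 1 * f 0)) (i : Fin 2) : planeLift q f hf (planeGen q i) = f i := by
  unfold planeLift planeGen
  erw [RingQuot.liftAlgHom_mkAlgHom_apply]
  simp

/-- The values of the right coaction on `x` and `y`. -/
def coactGen (q : Param) : Fin 2 → Plane q ⊗[ℂ] Coord q :=
  ![planeGen q 0 ⊗ₜ gen q .a + planeGen q 1 ⊗ₜ gen q .c,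
    planeGen q 0 ⊗ₜ gen q .b + planeGen q 1 ⊗ₜ gen q .d]

theorem coactGen_rel (q : Param) :
    coactGen q 0 * coactGen q 1 = cq q • (coactGen q 1 * coactGen q 0) := by
  have h := isQuad_gen q
  have hq := cq_ne q
  simp only [coactGen, Matrix.cons_val_zero, Matrix.cons_val_one, add_mul, mul_add,
    Algebra.TensorProduct.tmul_mul_tmul, plane_xy, ← h.bc, h.ad, h.da, h.ab, h.ac, h.bd, h.cd,
    TensorProduct.add_tmul, TensorProduct.tmul_add, TensorProduct.tmul_smul,
    ← TensorProduct.smul_tmul']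
  match_scalars <;> field_simp

/-- The right coaction on the quantum plane: the algebra homomorphism with
`R(x) = x ⊗ a + y ⊗ c` and `R(y) = x ⊗ b + y ⊗ d`. -/
def coact (q : Param) : Plane q →ₐ[ℂ] Plane q ⊗[ℂ] Coord q :=
  planeLift q (coactGen q) (coactGen_rel q)

/-- The deformed factorial `∏_{i < n} (1 + p + ⋯ + p^i)`. -/
def qFact (p : ℝ) (n : ℕ) : ℝ := ∏ i ∈ Finset.range n, ∑ j ∈ Finset.range (i + 1), p ^ j

/-- The Gaussian binomial coefficient with parameter `p` (used for `k ≤ n`). -/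
def qBinom (p : ℝ) (n k : ℕ) : ℝ := qFact p n / (qFact p k * qFact p (n - k))

/-- The square root of the Gaussian binomial coefficient with parameter `q⁻²`. -/
def rootBinom (q : Param) (N k : ℕ) : ℂ := ((Real.sqrt (qBinom ((q : ℝ) ^ 2)⁻¹ N k) : ℝ) : ℂ)

/-- The normalized monomial basis of the homogeneous polynomials of degree `N = 2 l` on the quantum
plane; the position `k` stands for the index `k - l` in `{-l, …, l}`. -/
def planeBasis (q : Param) (N k : ℕ) : Plane q :=
  rootBinom q N k • (planeGen q 0 ^ (N - k) * planeGen q 1 ^ k)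

/-- The coefficient of `x^{m+n-k} y^k` in `R(x)^m R(y)^n`. -/
def coactCoeff (q : Param) : ℕ → ℕ → ℕ → Coord q
  | 0, 0, 0 => 1
  | 0, 0, _ + 1 => 0
  | 0, n + 1, 0 => gen q .b * coactCoeff q 0 n 0
  | 0, n + 1, k + 1 => gen q .b * coactCoeff q 0 n (k + 1) +
      (cq q ^ (n - k))⁻¹ • (gen q .d * coactCoeff q 0 n k)
  | m + 1, n, 0 => gen q .a * coactCoeff q m n 0
  | m + 1, n, k + 1 => gen q .a * coactCoeff q m n (k + 1) +
      (cq q ^ (m + n - k))⁻¹ • (gen q .c * coactCoeff q m n k)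

/-- The matrix `T^{(l)} = [t^l_{ij}]`, `l = N / 2`, of the unitary irreducible corepresentation
on the homogeneous polynomials of degree `N` on the quantum plane. -/
def tMat (q : Param) (N : ℕ) : Matrix (Fin (N + 1)) (Fin (N + 1)) (Coord q) :=
  Matrix.of fun i j => (rootBinom q N j / rootBinom q N i) • coactCoeff q (N - j) j i

theorem coactCoeff_zero (q : Param) (m n k : ℕ) (hk : m + n < k) : coactCoeff q m n k = 0 := by
  induction m generalizing k with
  | zero =>
    induction n generalizing k with
    | zero => cases k with
      | zero => omega
      | succ k => rw [coactCoeff]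
    | succ n ih => cases k with
      | zero => omega
      | succ k => rw [coactCoeff, ih _ (by omega), ih _ (by omega)]; simp
  | succ m ih => cases k with
    | zero => omega
    | succ k => rw [coactCoeff, ih _ (by omega), ih _ (by omega)]; simp

theorem plane_y_mul_x_pow (q : Param) (n : ℕ) :
    planeGen q 1 * planeGen q 0 ^ n = (cq q ^ n)⁻¹ • (planeGen q 0 ^ n * planeGen q 1) := by
  have hq := cq_ne q
  have h : planeGen q 1 * planeGen q 0 = (cq q)⁻¹ • (planeGen q 0 * planeGen q 1) := by
    rw [plane_xy, smul_smul, inv_mul_cancel₀ hq, one_smul]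
  induction n with
  | zero => simp
  | succ n ih =>
    rw [pow_succ, ← mul_assoc, ih, smul_mul_assoc, mul_assoc, h, mul_smul_comm, smul_smul,
      ← mul_assoc, pow_succ, mul_inv]

theorem coact_step (q : Param) (N : ℕ) (u v : Coord q) (f : ℕ → Coord q) (g : ℕ → Coord q)
    (hf : f (N + 1) = 0) (h0 : g 0 = u * f 0)
    (h1 : ∀ k, g (k + 1) = u * f (k + 1) + (cq q ^ (N - k))⁻¹ • (v * f k)) :
    (planeGen q 0 ⊗ₜ[ℂ] u + planeGen q 1 ⊗ₜ[ℂ] v) *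
      ∑ k ∈ Finset.range (N + 1), (planeGen q 0 ^ (N - k) * planeGen q 1 ^ k) ⊗ₜ[ℂ] f k =
    ∑ k ∈ Finset.range (N + 1 + 1),
      (planeGen q 0 ^ (N + 1 - k) * planeGen q 1 ^ k) ⊗ₜ[ℂ] g k := by
  rw [add_mul, Finset.sum_range_succ' _ (N + 1), h0]
  have e : ∀ k ∈ Finset.range (N + 1),
      (planeGen q 0 ^ (N + 1 - (k + 1)) * planeGen q 1 ^ (k + 1)) ⊗ₜ[ℂ] g (k + 1) =
      (planeGen q 0 ^ (N + 1 - (k + 1)) * planeGen q 1 ^ (k + 1)) ⊗ₜ[ℂ] (u * f (k + 1)) +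
      planeGen q 1 ⊗ₜ[ℂ] v * (planeGen q 0 ^ (N - k) * planeGen q 1 ^ k) ⊗ₜ[ℂ] f k := by
    intro k _
    rw [h1, TensorProduct.tmul_add, Algebra.TensorProduct.tmul_mul_tmul, ← mul_assoc,
      plane_y_mul_x_pow, smul_mul_assoc, mul_assoc, ← pow_succ', TensorProduct.tmul_smul,
      TensorProduct.smul_tmul', Nat.add_sub_add_right]
  rw [Finset.sum_congr rfl e, Finset.sum_add_distrib, ← Finset.mul_sum, add_right_comm]
  congr 1
  have e2 := Finset.sum_range_succ'
    (fun k => (planeGen q 0 ^ (N + 1 - k) * planeGen q 1 ^ k) ⊗ₜ[ℂ] (u * f k)) (N + 1)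
  rw [← e2, Finset.sum_range_succ _ (N + 1), hf, mul_zero, TensorProduct.tmul_zero, add_zero, Finset.mul_sum]
  refine Finset.sum_congr rfl fun k hk => ?_
  have hk' : N + 1 - k = (N - k) + 1 := by
    have := Finset.mem_range.mp hk
    omega
  rw [Algebra.TensorProduct.tmul_mul_tmul, ← mul_assoc, ← pow_succ', hk']

theorem coact_monomial (q : Param) (m n : ℕ) : coact q (planeGen q 0 ^ m * planeGen q 1 ^ n) =
    ∑ k ∈ Finset.range (m + n + 1),
      (planeGen q 0 ^ (m + n - k) * planeGen q 1 ^ k) ⊗ₜ[ℂ] coactCoeff q m n k := by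
  have hx : coact q (planeGen q 0) = planeGen q 0 ⊗ₜ gen q .a + planeGen q 1 ⊗ₜ gen q .c := by
    rw [coact, planeLift_gen]; rfl
  have hy : coact q (planeGen q 1) = planeGen q 0 ⊗ₜ gen q .b + planeGen q 1 ⊗ₜ gen q .d := by
    rw [coact, planeLift_gen]; rfl
  induction m with
  | zero =>
    rw [pow_zero, one_mul]
    induction n with
    | zero => simp [coactCoeff, Algebra.TensorProduct.one_def]
    | succ n ih =>
      rw [pow_succ', map_mul, ih, hy]
      simp only [zero_add]
      refine coact_step q n _ _ _ _ (coactCoeff_zero _ _ _ _ (by omega)) ?_ fun k => ?_ <;>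
        rw [coactCoeff]
  | succ m ih =>
    rw [pow_succ', mul_assoc, map_mul, ih, hx, Nat.add_right_comm m 1 n]
    refine coact_step q (m + n) _ _ _ _ (coactCoeff_zero _ _ _ _ (by omega)) ?_ fun k => ?_ <;>
      rw [coactCoeff]

theorem qFact_pos {p : ℝ} (hp : 0 < p) (n : ℕ) : 0 < qFact p n :=
  Finset.prod_pos fun i _ => Finset.sum_pos (fun j _ => pow_pos hp j) ⟨0, by simp⟩

theorem rootBinom_ne (q : Param) (N k : ℕ) : rootBinom q N k ≠ 0 := by
  have hp : 0 < ((q : ℝ) ^ 2)⁻¹ := inv_pos.mpr (pow_pos (q_pos q) 2)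
  have : 0 < qBinom ((q : ℝ) ^ 2)⁻¹ N k :=
    div_pos (qFact_pos hp _) (mul_pos (qFact_pos hp _) (qFact_pos hp _))
  unfold rootBinom
  exact_mod_cast (Real.sqrt_pos.mpr this).ne'

/-- The matrix `T^{(l)}` is the matrix of the coaction in the normalized monomial basis. -/
theorem coact_planeBasis (q : Param) (N : ℕ) (j : Fin (N + 1)) :
    coact q (planeBasis q N j) = ∑ i : Fin (N + 1), planeBasis q N i ⊗ₜ[ℂ] tMat q N i j := by
  have hj : N - (j : ℕ) + j = N := by omega
  rw [planeBasis, map_smul, coact_monomial, hj, Finset.smul_sum, Finset.sum_range]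
  refine Finset.sum_congr rfl fun i _ => ?_
  rw [planeBasis, tMat, Matrix.of_apply, ← TensorProduct.smul_tmul', TensorProduct.tmul_smul,
    smul_smul, mul_div_cancel₀ _ (rootBinom_ne q N i)]

/-! ### Fourier analysis -/

/-- The `q`-number `[n]_q = (q^n - q^{-n}) / (q - q^{-1})`. -/
def qNum (q : Param) (n : ℕ) : ℂ := (cq q ^ n - (cq q ^ n)⁻¹) / (cq q - (cq q)⁻¹)

/-- Twice the index in `{-l, …, l}`, `l = N / 2`, at the position `k` in `{0, …, N}`. -/
def idx (N : ℕ) (k : Fin (N + 1)) : ℤ := 2 * (k : ℤ) - N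

/-- The Fourier transform of an element of the Hilbert space:
`f̂(l)_{mn} = h(f (t^l_{nm})*) = ⟨t^l_{nm}, f⟩`, `l = N / 2`. -/
def fourier (q : Param) (f : L2 q) (N : ℕ) : Matrix (Fin (N + 1)) (Fin (N + 1)) ℂ :=
  Matrix.of fun m n => inner ℂ (toL2 q (tMat q N n m)) f

theorem fourier_toL2 (q : Param) (f : Coord q) (N : ℕ) (m n : Fin (N + 1)) :
    fourier q (toL2 q f) N m n = haar q (f * star (tMat q N n m)) := inner_toL2 q _ _

/-- The diagonal matrix `D_q` with entries `q^{-2i}`, `i ∈ {-l, …, l}`. -/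
def dMat (q : Param) (N : ℕ) : Matrix (Fin (N + 1)) (Fin (N + 1)) ℂ :=
  Matrix.diagonal fun i => cq q ^ (-idx N i)

/-- The functional `Tr_q(A) = Tr(D_q A)` on matrices over the coordinate algebra. -/
def qTrace (q : Param) (N : ℕ) (A : Matrix (Fin (N + 1)) (Fin (N + 1)) (Coord q)) : Coord q :=
  ((dMat q N).map (algebraMap ℂ (Coord q)) * A).trace

/-! ### Pseudo-differential operators -/

/-- A symbol: a function assigning to each `l = N / 2` a matrix of size `2 l + 1` over the
coordinate algebra. -/
abbrev Symb (q : Param) : Type := (N : ℕ) → Matrix (Fin (N + 1)) (Fin (N + 1)) (Coord q)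

/-- The summand `[2l+1]_q Tr_q(σ(l) f̂(l) T^{(l)})`, `l = N / 2`. -/
def opTerm (q : Param) (σ : Symb q) (f : L2 q) (N : ℕ) : Coord q :=
  qNum q (N + 1) • qTrace q N (σ N * (fourier q f N).map (algebraMap ℂ (Coord q)) * tMat q N)

/-- `A` is a pseudo-differential operator with symbol `σ`: a linear operator in the Hilbert space
`L²(SU_q(2))`, defined on a subspace that contains the coordinate algebra (and not necessarily
bounded or closed), such that for each `f` in its domain
`A f = ∑_l [2l+1]_q Tr_q(σ(l) f̂(l) T^{(l)})`, with convergence in `L²(SU_q(2))`. -/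
structure HasSymbol (q : Param) (A : L2 q →ₗ.[ℂ] L2 q) (σ : Symb q) : Prop where
  coord_mem (x : Coord q) : toL2 q x ∈ A.domain
  hasSum (f : A.domain) : HasSum (fun N => toL2 q (opTerm q σ f N)) (A f)

/-- A pseudo-differential operator. -/
def IsPseudoDifferential (q : Param) (A : L2 q →ₗ.[ℂ] L2 q) : Prop := ∃ σ, HasSymbol q A σ

/-- The composition of two partially defined operators, on its natural domain
`{f ∈ dom B | B f ∈ dom A}`. -/
def opComp {H : Type*} [AddCommGroup H] [Module ℂ H] (A B : H →ₗ.[ℂ] H) : H →ₗ.[ℂ] H :=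
  A.comp (B.domRestrict ((A.domain.comap B.toFun).map B.domain.subtype)) (by
    rintro ⟨f, ⟨g, hg, rfl⟩, hf⟩
    exact hg)

theorem mem_opComp_domain {H : Type*} [AddCommGroup H] [Module ℂ H] (A B : H →ₗ.[ℂ] H) (f : H) :
    f ∈ (opComp A B).domain ↔ ∃ hf : f ∈ B.domain, B ⟨f, hf⟩ ∈ A.domain := by
  constructor
  · rintro ⟨⟨g, hg, rfl⟩, hf⟩
    exact ⟨hf, hg⟩
  · rintro ⟨hf, h⟩
    exact ⟨⟨⟨f, hf⟩, h, rfl⟩, hf⟩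

theorem opComp_apply {H : Type*} [AddCommGroup H] [Module ℂ H] (A B : H →ₗ.[ℂ] H) (f : H)
    (hf : f ∈ (opComp A B).domain) (hB : f ∈ B.domain) (hA : B ⟨f, hB⟩ ∈ A.domain) :
    opComp A B ⟨f, hf⟩ = A ⟨B ⟨f, hB⟩, hA⟩ := rfl

/-- A homogeneous symbol of Fourier order `m / 2`: each entry is a multiple of a single
`t^{m/2}_{rs}`, whose indices depend on the position of the entry, and vanishes when these
indices are out of range.  The index map `ψ` takes values in pairs of half-integers, which are
recorded by their doubles. -/
def IsHomogeneous (q : Param) (m : ℕ) (σ : Symb q) : Prop :=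
  ∃ ψ : (N : ℕ) → Fin (N + 1) × Fin (N + 1) → ℤ × ℤ, ∀ (N : ℕ) (i j : Fin (N + 1)),
    (∀ r s : Fin (m + 1), ψ N (i, j) = (idx m r, idx m s) →
      σ N i j ∈ Submodule.span ℂ {tMat q m r s}) ∧
    ((∀ r s : Fin (m + 1), ψ N (i, j) ≠ (idx m r, idx m s)) → σ N i j = 0)

/-- The class `Φ^{m/2}(SU_q(2))` of symbols of Fourier order `m / 2`: linear combinations of
homogeneous symbols of this order. -/
def symbClass (q : Param) (m : ℕ) : Submodule ℂ (Symb q) :=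
  Submodule.span ℂ {σ | IsHomogeneous q m σ}

end SUq2
end

/-!
A symbol of Fourier order zero has scalar entries, so an operator `B` with such a symbol is a
Fourier multiplier: the Fourier coefficients of `B f` at `l` are `σ_B(l) f̂(l)`
(`HasSymbol.fourier_apply`). Substituting this into the series of `A (B f)` gives the series of the
product symbol. For `f` in the coordinate algebra only finitely many `f̂(l)` are nonzero, hence
`B f` is again in the coordinate algebra (`HasSymbol.exists_apply_toL2`), and the composition is
defined there.

The multiplier property is Schur orthogonality, in the precise form
`h(t^l_{ij} (t^m_{kr})^*) = δ_{lm} δ_{ik} δ_{jr} q^{2j} / [2l+1]_q` (`haar_tMat_mul_star`,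
`haar_tMat_mul_star_of_ne`), combined with the continuity of the inner product. It is proved with
ladder operators. The generators of `U_q(sl_2)` act on the coordinate algebra from both sides by
twisted derivations (`rowDer`, `colDer`), which have formal adjoints for the Haar inner product
because the Haar functional is invariant (`TwistedDer.haar_δ_mul_star`).

* The matrix entries are weight vectors for both twisting automorphisms, and weight vectors of
  different weights are orthogonal. This gives the orthogonality within one `l`.
* The derivations and their adjoints move along the rows and the columns of `T^l` with explicit
  factors (`colDer_coactCoeff`, `colDer_adj_coactCoeff`, `rowDer_coactCoeff`,
  `rowDer_adj_coactCoeff`). This reduces all norms to that of `c^{2l}`, a geometric series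
  (`haar_c_pow`).
* An element of degree `d` in the generators has column weights in `[-d, d]` only, while the first
  column of `T^l` has weight `2l`. So `t^l_{ij}` is orthogonal to everything of degree less than
  `2l` in the first column, and in the other columns because the adjoint of the column derivation
  does not raise the degree (`haar_mul_star_coactCoeff_of_degree`). This gives both the
  orthogonality for different `l` and the finiteness of the Fourier transform.
-/

open scoped TensorProduct ComplexConjugate InnerProductSpace
noncomputable section
namespace SUq2

/-! ### Twisted derivations and their adjoints -/

/-- A twisted derivation `δ` of the coordinate algebra, `δ (x y) = κ x δ y + δ x y`, whose
twisting automorphism `κ` satisfies `κ⁻¹ = star ∘ κ ∘ star`, and such that the Haar functional is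
`κ`-invariant and annihilates the range of `δ`. -/
structure TwistedDer (q : Param) where
  /-- The twisting automorphism. -/
  κ : Coord q →ₐ[ℂ] Coord q
  /-- The derivation. -/
  δ : Coord q →ₗ[ℂ] Coord q
  κ_star_κ (x : Coord q) : κ (star (κ x)) = star x
  haar_κ (x : Coord q) : haar q (κ x) = haar q x
  haar_δ (x : Coord q) : haar q (δ x) = 0
  δ_mul (x y : Coord q) : δ (x * y) = κ x * δ y + δ x * y

namespace TwistedDer

variable {q : Param} (D : TwistedDer q)

theorem δ_one : D.δ 1 = 0 := by
  have h := D.δ_mul 1 1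
  rwa [mul_one, map_one D.κ, one_mul, mul_one, left_eq_add] at h

/-- The formal adjoint of a twisted derivation for the inner product `h (x w*)`. -/
def adj : Coord q →ₗ[ℂ] Coord q where
  toFun w := -D.κ (star (D.δ (star w)))
  map_add' x y := by simp only [star_add, map_add, neg_add]
  map_smul' z x := by simp [star_smul]

theorem adj_apply (w : Coord q) : D.adj w = -D.κ (star (D.δ (star w))) := rfl

theorem κ_star_κ_star (x : Coord q) : D.κ (star (D.κ (star x))) = x := by
  rw [D.κ_star_κ, star_star]

theorem haar_δ_mul_star (x w : Coord q) :
    haar q (D.δ x * star w) = haar q (x * star (D.adj w)) := by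
  have h := D.haar_δ (x * star w)
  rw [D.δ_mul, map_add, ← D.κ_star_κ_star (D.δ (star w)), ← map_mul, D.haar_κ] at h
  rw [adj_apply, star_neg, mul_neg, map_neg]
  exact eq_neg_of_add_eq_zero_right h

theorem haar_mul_star_δ (x w : Coord q) :
    haar q (x * star (D.δ w)) = haar q (D.adj x * star w) := by
  rw [← haar_conj, D.haar_δ_mul_star, haar_conj]

theorem adj_mul (x y : Coord q) : D.adj (x * y) = D.κ x * D.adj y + D.adj x * y := by
  simp only [adj_apply, star_mul, D.δ_mul, star_add, map_add, map_mul, D.κ_star_κ_star, star_star]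
  noncomm_ring

theorem adj_one : D.adj 1 = 0 := by simp [adj_apply, D.δ_one]

/-- Weight vectors of different weights are orthogonal. -/
theorem haar_mul_star_of_weight {x w : Coord q} {i j : ℤ} (hx : D.κ x = cq q ^ i • x)
    (hw : D.κ w = cq q ^ j • w) (hij : i ≠ j) : haar q (x * star w) = 0 := by
  have hq := cq_ne q
  have hw' : cq q ^ j • D.κ (star w) = star w := by
    have h := D.κ_star_κ w
    rwa [hw, star_smul, RCLike.star_def, map_zpow₀, conj_cq, map_smul] at h
  have h : cq q ^ j * haar q (x * star w) = cq q ^ i * haar q (x * star w) := by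
    conv_lhs => rw [← D.haar_κ, map_mul, hx]
    rw [← smul_eq_mul, ← map_smul, smul_mul_assoc, smul_comm, ← mul_smul_comm, hw', map_smul,
      smul_eq_mul]
  by_contra h0
  have h1 : (q : ℝ) ^ j = (q : ℝ) ^ i := by
    have := mul_right_cancel₀ h0 h
    unfold cq at this
    exact_mod_cast this
  exact hij (zpow_right_injective₀ (q_pos q) (q_lt q).ne h1).symm

end TwistedDer

theorem kap_star_kap (q : Param) (x : Coord q) : kap q (star (kap q x)) = star x := by
  have hq := cq_ne q
  induction x using coord_induction with
  | hs z => simp only [AlgHom.commutes, coord_star_algebraMap]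
  | hg g =>
    cases g <;> simp [kap_gen, kapGen, coord_star_smul, coord_star_gen, starGen, conj_cq, smul_smul,
      hq, -neg_smul]
  | hadd x y hx hy => simp only [map_add, star_add, hx, hy]
  | hmul x y hx hy => simp only [map_mul, star_mul, hx, hy]

/-- The derivation that raises the row index, `a ↦ c`, `b ↦ d`. -/
def rowDer (q : Param) : TwistedDer q where
  κ := kap q
  δ := der q
  κ_star_κ := kap_star_kap q
  haar_κ := haar_kap q
  haar_δ := haar_der q
  δ_mul := der_mul q

/-- The automorphism scaling the columns of the generating matrix. -/
def kapCol (q : Param) : Coord q →ₐ[ℂ] Coord q := (trans q).comp ((kap q).comp (trans q))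

theorem kapCol_apply (q : Param) (x : Coord q) : kapCol q x = trans q (kap q (trans q x)) := rfl

theorem kapCol_star_kapCol (q : Param) (x : Coord q) :
    kapCol q (star (kapCol q x)) = star x := by
  have hq := cq_ne q
  induction x using coord_induction with
  | hs z => simp only [AlgHom.commutes, coord_star_algebraMap]
  | hg g =>
    cases g <;> simp [kapCol_apply, trans_gen, transGen, kap_gen, kapGen, coord_star_smul,
      coord_star_gen, starGen, conj_cq, smul_smul, hq, -neg_smul]
  | hadd x y hx hy => simp only [map_add, star_add, hx, hy]
  | hmul x y hx hy => simp only [map_mul, star_mul, hx, hy]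

/-- The derivation that raises the column index, `a ↦ b`, `c ↦ d`. -/
def colDer (q : Param) : TwistedDer q where
  κ := kapCol q
  δ := (trans q).toLinearMap ∘ₗ der q ∘ₗ (trans q).toLinearMap
  κ_star_κ := kapCol_star_kapCol q
  haar_κ x := by rw [kapCol_apply, haar_trans, haar_kap, haar_trans]
  haar_δ x := by
    simp only [LinearMap.comp_apply, AlgHom.toLinearMap_apply, haar_trans, haar_der]
  δ_mul x y := by
    simp only [LinearMap.comp_apply, AlgHom.toLinearMap_apply, map_mul, der_mul, map_add,
      trans_trans, kapCol_apply]

theorem rowDer_κ (q : Param) (g : Gen) : (rowDer q).κ (gen q g) = kapGen q g := kap_gen q g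

theorem rowDer_δ (q : Param) (g : Gen) : (rowDer q).δ (gen q g) = derGen q g := der_gen q g

theorem colDer_κ (q : Param) (g : Gen) :
    (colDer q).κ (gen q g) = trans q (kap q (transGen q g)) := by
  rw [← trans_gen]; rfl

theorem colDer_δ (q : Param) (g : Gen) :
    (colDer q).δ (gen q g) = trans q (der q (transGen q g)) := by
  rw [← trans_gen]; rfl

theorem colDer_κ_gen (q : Param) :
    (colDer q).κ (gen q .a) = cq q • gen q .a ∧
      (colDer q).κ (gen q .b) = (cq q)⁻¹ • gen q .b ∧
      (colDer q).κ (gen q .c) = cq q • gen q .c ∧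
      (colDer q).κ (gen q .d) = (cq q)⁻¹ • gen q .d := by
  simp [colDer_κ, transGen, kap_gen, kapGen, trans_gen]

theorem colDer_δ_gen (q : Param) :
    (colDer q).δ (gen q .a) = gen q .b ∧ (colDer q).δ (gen q .b) = 0 ∧
      (colDer q).δ (gen q .c) = gen q .d ∧ (colDer q).δ (gen q .d) = 0 := by
  simp [colDer_δ, transGen, der_gen, derGen, trans_gen]

/-- The values of the adjoint of the row derivation on generators: `c ↦ a`, `d ↦ b`. -/
theorem rowDer_adj (q : Param) :
    (rowDer q).adj (gen q .a) = 0 ∧ (rowDer q).adj (gen q .b) = 0 ∧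
      (rowDer q).adj (gen q .c) = gen q .a ∧ (rowDer q).adj (gen q .d) = gen q .b := by
  have hq := cq_ne q
  refine ⟨?_, ?_, ?_, ?_⟩ <;>
    simp [TwistedDer.adj_apply, coord_star_gen, starGen, rowDer_δ, rowDer_κ, derGen, kapGen,
      coord_star_smul, conj_cq, smul_smul, hq]

/-- The values of the adjoint of the column derivation on generators:
`b ↦ q² a`, `d ↦ q² c`. -/
theorem colDer_adj (q : Param) :
    (colDer q).adj (gen q .a) = 0 ∧ (colDer q).adj (gen q .c) = 0 ∧
      (colDer q).adj (gen q .b) = cq q ^ 2 • gen q .a ∧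
      (colDer q).adj (gen q .d) = cq q ^ 2 • gen q .c := by
  have hq := cq_ne q
  refine ⟨?_, ?_, ?_, ?_⟩ <;>
    simp [TwistedDer.adj_apply, coord_star_gen, starGen, colDer_δ, colDer_κ, derGen, kapGen,
      trans_gen, transGen, kap_gen, der_gen,
      coord_star_smul, conj_cq, smul_smul, hq, pow_two]

/-! ### The coefficients of the powers `R(x)ᵐ R(y)ⁿ` of the coaction `R` -/

/-- Left multiplication by `x ⊗ u + y ⊗ v` on `∑ₖ xᴺ⁻ᵏ yᵏ ⊗ f k`, in terms of coefficients. -/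
def step (q : Param) (N : ℕ) (u v : Coord q) (f : ℕ → Coord q) : ℕ → Coord q
  | 0 => u * f 0
  | k + 1 => u * f (k + 1) + (cq q ^ k * (cq q ^ N)⁻¹) • (v * f k)

theorem step_smul (q : Param) (N : ℕ) (u v : Coord q) (z : ℂ) (f : ℕ → Coord q) :
    step q N u v (z • f) = z • step q N u v f := by
  ext k
  cases k <;> simp [step, mul_smul_comm, smul_comm z]

theorem step_smul_left (q : Param) (N : ℕ) (u v : Coord q) (z : ℂ) (f : ℕ → Coord q) :
    step q N (z • u) (z • v) f = z • step q N u v f := by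
  ext k
  cases k <;> simp [step, smul_mul_assoc, smul_comm z]

theorem step_zero_left (q : Param) (N : ℕ) (f : ℕ → Coord q) : step q N 0 0 f = 0 := by
  ext k
  cases k <;> simp [step]

theorem coactCoeff_succ_left (q : Param) (m n : ℕ) : coactCoeff q (m + 1) n =
    step q (m + n) (gen q .a) (gen q .c) (coactCoeff q m n) := by
  have hq := cq_ne q
  ext k
  cases k with
  | zero => rw [coactCoeff, step]
  | succ k =>
    rw [coactCoeff, step]
    rcases lt_or_ge (m + n) k with h | h
    · simp [coactCoeff_zero q m n k h]
    · obtain ⟨s, hs⟩ := Nat.exists_eq_add_of_le h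
      rw [hs, Nat.add_sub_cancel_left, pow_add]
      congr 2
      field_simp

theorem coactCoeff_succ_right (q : Param) (n : ℕ) : coactCoeff q 0 (n + 1) =
    step q n (gen q .b) (gen q .d) (coactCoeff q 0 n) := by
  have hq := cq_ne q
  ext k
  cases k with
  | zero => rw [coactCoeff, step]
  | succ k =>
    rw [coactCoeff, step]
    rcases lt_or_ge n k with h | h
    · simp [coactCoeff_zero q 0 n k (by omega)]
    · obtain ⟨s, hs⟩ := Nat.exists_eq_add_of_le h
      rw [hs, Nat.add_sub_cancel_left, pow_add]
      congr 2
      field_simp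

/-- The induction principle that treats all products of `R(x)` and `R(y)` alike. -/
theorem coactCoeff_induction {q : Param} {P : ℕ → (ℕ → Coord q) → Prop}
    (h0 : P 0 (coactCoeff q 0 0))
    (ha : ∀ N f, P N f → P (N + 1) (step q N (gen q .a) (gen q .c) f))
    (hb : ∀ N f, P N f → P (N + 1) (step q N (gen q .b) (gen q .d) f)) (m n : ℕ) :
    P (m + n) (coactCoeff q m n) := by
  induction m with
  | zero =>
    rw [zero_add]
    induction n with
    | zero => exact h0
    | succ n ih => rw [coactCoeff_succ_right]; exact hb _ _ ih
  | succ m ih => rw [coactCoeff_succ_left, Nat.add_right_comm]; exact ha _ _ ih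

theorem map_step {q : Param} (φ : Coord q →ₐ[ℂ] Coord q) (N : ℕ) (u v : Coord q)
    (f : ℕ → Coord q) : φ ∘ step q N u v f = step q N (φ u) (φ v) (φ ∘ f) := by
  ext k
  cases k <;> simp [step]

/-- The Leibniz rule for multiplication by `x ⊗ u + y ⊗ v`. -/
theorem leibniz_step {q : Param} (κ : Coord q →ₐ[ℂ] Coord q) (δ : Coord q →ₗ[ℂ] Coord q)
    (h : ∀ x y, δ (x * y) = κ x * δ y + δ x * y) (N : ℕ) (u v : Coord q) (f : ℕ → Coord q) :
    δ ∘ step q N u v f = step q N (κ u) (κ v) (δ ∘ f) + step q N (δ u) (δ v) f := by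
  ext k
  cases k with
  | zero => simp [step, h]
  | succ k =>
    simp only [step, Function.comp_apply, Pi.add_apply, map_add, map_smul, h, smul_add]
    abel

/-- The relation `R(y) R(x) = q⁻¹ R(x) R(y)`, in terms of coefficients. -/
theorem step_comm (q : Param) (N : ℕ) (f : ℕ → Coord q) :
    step q (N + 1) (gen q .b) (gen q .d) (step q N (gen q .a) (gen q .c) f) =
      (cq q)⁻¹ • step q (N + 1) (gen q .a) (gen q .c) (step q N (gen q .b) (gen q .d) f) := by
  have h := isQuad_gen q
  have hq := cq_ne q
  ext k
  match k with
  | 0 =>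
    simp only [step, Pi.smul_apply, ← mul_assoc, h.ab, smul_mul_assoc, smul_smul,
      inv_mul_cancel₀ hq, one_smul]
  | 1 =>
    simp only [step, Pi.smul_apply, ← mul_assoc, mul_add, mul_smul_comm, h.ab, h.ad, h.da, ← h.bc,
      smul_mul_assoc, add_mul, one_mul]
    match_scalars <;> field_simp <;> ring
  | k + 2 =>
    simp only [step, Pi.smul_apply, ← mul_assoc, mul_add, mul_smul_comm, h.ab, h.cd, h.ad, h.da,
      ← h.bc, smul_mul_assoc, add_mul, one_mul]
    match_scalars <;> field_simp <;> ring

theorem step_coactCoeff (q : Param) (m n : ℕ) :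
    step q (m + n) (gen q .b) (gen q .d) (coactCoeff q m n) =
      (cq q ^ m)⁻¹ • coactCoeff q m (n + 1) := by
  induction m with
  | zero => rw [coactCoeff_succ_right]; simp
  | succ m ih =>
    rw [coactCoeff_succ_left, coactCoeff_succ_left, Nat.add_right_comm, step_comm, ih, step_smul,
      smul_smul, pow_succ', mul_inv]
    rfl

/-! ### Ladder formulas -/

/-- The deformed number `1 + p + ⋯ + pⁿ⁻¹` with `p = q⁻²`. -/
def pNum (q : Param) (n : ℕ) : ℝ := ∑ j ∈ Finset.range n, (((q : ℝ) ^ 2)⁻¹) ^ j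

theorem pNum_pos (q : Param) (n : ℕ) : 0 < pNum q (n + 1) :=
  Finset.sum_pos (fun _ _ => pow_pos (inv_pos.mpr (pow_pos (q_pos q) 2)) _) ⟨0, by simp⟩

theorem pNum_zero (q : Param) : pNum q 0 = 0 := by simp [pNum]

theorem pNum_succ (q : Param) (n : ℕ) :
    (pNum q (n + 1) : ℂ) = pNum q n + (cq q ^ (2 * n))⁻¹ := by
  rw [pNum, Finset.sum_range_succ, ← pNum, cq, pow_mul]
  push_cast
  rw [inv_pow]

theorem pNum_succ' (q : Param) (n : ℕ) :
    (pNum q (n + 1) : ℂ) = (cq q ^ 2)⁻¹ * pNum q n + 1 := by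
  rw [pNum, Finset.sum_range_succ', pNum, cq]
  push_cast
  rw [Finset.mul_sum]
  simp [pow_succ']

/-- The column derivation maps the coefficients of `R(x)ᵐ⁺¹ R(y)ⁿ` to multiples of those of
`R(x)ᵐ R(y)ⁿ⁺¹`. -/
theorem colDer_coactCoeff (q : Param) (m n : ℕ) : (colDer q).δ ∘ coactCoeff q (m + 1) n =
    (cq q ^ m * pNum q (m + 1)) • coactCoeff q m (n + 1) := by
  have hq := cq_ne q
  have e := leibniz_step _ _ (colDer q).δ_mul
  obtain ⟨ka, -, kc, -⟩ := colDer_κ_gen q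
  obtain ⟨da, -, dc, -⟩ := colDer_δ_gen q
  induction m with
  | zero =>
    have h0 : (colDer q).δ ∘ coactCoeff q 0 n = 0 := by
      induction n with
      | zero =>
        ext k
        cases k <;> simp [coactCoeff, TwistedDer.δ_one]
      | succ n ih =>
        obtain ⟨-, db, -, dd⟩ := colDer_δ_gen q
        rw [coactCoeff_succ_right, e, ih, db, dd, step_zero_left, add_zero]
        ext k
        cases k <;> simp [step]
    rw [coactCoeff_succ_left, e, h0, da, dc, step_coactCoeff]
    have h1 : step q (0 + n) ((colDer q).κ (gen q .a)) ((colDer q).κ (gen q .c)) 0 = 0 := by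
      ext k
      cases k <;> simp [step]
    rw [h1]
    simp [pNum]
  | succ m ih =>
    rw [coactCoeff_succ_left, e, ih, ka, kc, da, dc, step_coactCoeff, step_smul_left, step_smul,
      Nat.add_right_comm m 1 n, add_assoc m n 1, ← coactCoeff_succ_left, smul_smul, ← add_smul,
      pNum_succ q (m + 1)]
    congr 1
    field_simp
    ring

/-- The adjoint of the column derivation maps the coefficients of `R(x)ᵐ R(y)ⁿ⁺¹` to multiples of
those of `R(x)ᵐ⁺¹ R(y)ⁿ`. -/
theorem colDer_adj_coactCoeff (q : Param) (m n : ℕ) :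
    (colDer q).adj ∘ coactCoeff q m (n + 1) =
      (cq q ^ (m + 2) * pNum q (n + 1)) • coactCoeff q (m + 1) n := by
  have hq := cq_ne q
  have e := leibniz_step _ _ (colDer q).adj_mul
  obtain ⟨da, dc, db, dd⟩ := colDer_adj q
  induction m with
  | zero =>
    obtain ⟨-, kb, -, kd⟩ := colDer_κ_gen q
    induction n with
    | zero =>
      have h0 : (colDer q).adj ∘ coactCoeff q 0 0 = 0 := by
        ext k
        cases k <;> simp [coactCoeff, TwistedDer.adj_one]
      have h1 : step q 0 ((colDer q).κ (gen q .b)) ((colDer q).κ (gen q .d)) 0 = 0 := by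
        ext k
        cases k <;> simp [step]
      rw [coactCoeff_succ_right, e, h0, h1, db, dd, step_smul_left, coactCoeff_succ_left]
      simp [pNum]
    | succ n ih =>
      have h1 := step_coactCoeff q 1 n
      have h2 := coactCoeff_succ_left q 0 (n + 1)
      rw [zero_add, zero_add] at h2
      rw [add_comm 1 n] at h1
      rw [coactCoeff_succ_right, e, ih, kb, kd, db, dd, step_smul_left, step_smul_left, step_smul,
        zero_add 1, h1, ← h2, smul_smul, smul_smul, ← add_smul,
        pNum_succ' q (n + 1)]
      congr 1
      field_simp
      ring
  | succ m ih =>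
    obtain ⟨ka, -, kc, -⟩ := colDer_κ_gen q
    rw [coactCoeff_succ_left, e, ih, ka, kc, da, dc, step_zero_left, add_zero, step_smul_left,
      step_smul, smul_smul, coactCoeff_succ_left q (m + 1) n, ← add_assoc m n 1,
      Nat.add_right_comm m n 1]
    congr 1
    ring

/-- The row derivation raises the exponent of `y` in the coefficients of the coaction. -/
theorem rowDer_coactCoeff (q : Param) (m n k : ℕ) : (rowDer q).δ (coactCoeff q m n k) =
    (cq q ^ (m + n) * (cq q ^ (k + 1))⁻¹ * pNum q (k + 1)) • coactCoeff q m n (k + 1) := by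
  have hq := cq_ne q
  have key : ∀ u v : Coord q, (rowDer q).κ u = cq q • u → (rowDer q).κ v = (cq q)⁻¹ • v →
      (rowDer q).δ u = v → (rowDer q).δ v = 0 → ∀ N f,
      (∀ k, (rowDer q).δ (f k) = (cq q ^ N * (cq q ^ (k + 1))⁻¹ * pNum q (k + 1)) • f (k + 1)) →
      ∀ k, (rowDer q).δ (step q N u v f k) =
        (cq q ^ (N + 1) * (cq q ^ (k + 1))⁻¹ * pNum q (k + 1)) • step q N u v f (k + 1) := by
    intro u v hu hv du dv N f hf k
    have hm := (rowDer q).δ_mul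
    cases k with
    | zero =>
      simp only [step, hm, hu, du, hf, pNum_succ, pNum_zero, smul_mul_assoc, mul_smul_comm,
        zero_add]
      match_scalars <;> simp <;> field_simp <;> ring
    | succ k =>
      simp only [step, map_add, map_smul, hm, hu, hv, du, dv, hf, zero_mul, add_zero,
        pNum_succ' q (k + 1), smul_mul_assoc, mul_smul_comm]
      match_scalars <;> field_simp <;> ring
  refine coactCoeff_induction (P := fun N f => ∀ k, (rowDer q).δ (f k) =
    (cq q ^ N * (cq q ^ (k + 1))⁻¹ * pNum q (k + 1)) • f (k + 1)) ?_ ?_ ?_ m n k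
  · intro k
    cases k <;> simp [coactCoeff, TwistedDer.δ_one]
  · exact key _ _ (rowDer_κ q .a) (rowDer_κ q .c) (rowDer_δ q .a) (rowDer_δ q .c)
  · exact key _ _ (rowDer_κ q .b) (rowDer_κ q .d) (rowDer_δ q .b) (rowDer_δ q .d)

/-- The adjoint of the row derivation lowers the exponent of `y` in the coefficients of the
coaction. -/
theorem rowDer_adj_coactCoeff (q : Param) (m n k : ℕ) :
    (rowDer q).adj (coactCoeff q m n (k + 1)) =
      (cq q ^ (m + n) * (cq q ^ (k + 1))⁻¹ * pNum q (m + n - k)) • coactCoeff q m n k := by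
  have hq := cq_ne q
  have key : ∀ u v : Coord q, (rowDer q).κ u = cq q • u → (rowDer q).κ v = (cq q)⁻¹ • v →
      (rowDer q).adj u = 0 → (rowDer q).adj v = u → ∀ N f,
      ((∀ k, N < k → f k = 0) ∧ (rowDer q).adj (f 0) = 0 ∧ ∀ k, (rowDer q).adj (f (k + 1)) =
        (cq q ^ N * (cq q ^ (k + 1))⁻¹ * pNum q (N - k)) • f k) →
      ((∀ k, N + 1 < k → step q N u v f k = 0) ∧ (rowDer q).adj (step q N u v f 0) = 0 ∧
        ∀ k, (rowDer q).adj (step q N u v f (k + 1)) =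
        (cq q ^ (N + 1) * (cq q ^ (k + 1))⁻¹ * pNum q (N + 1 - k)) • step q N u v f k) := by
    -- the vanishing of `f k` for `k > N` is needed because the subtraction in `pNum q (N - k)`
    -- is truncated
    rintro u v hu hv du dv N f ⟨hz, hf0, hf⟩
    have hm := (rowDer q).adj_mul
    refine ⟨?_, ?_, ?_⟩
    · rintro (_ | k) hk
      · omega
      · simp [step, hz k (by omega), hz (k + 1) (by omega)]
    · simp [step, hm, hf0, du]
    · intro k
      have hs : ∀ k, k ≤ N → (pNum q (N + 1 - k) : ℂ) =
          pNum q (N - k) + cq q ^ (2 * k) * (cq q ^ (2 * N))⁻¹ := by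
        intro k hk
        obtain ⟨s, rfl⟩ := Nat.exists_eq_add_of_le hk
        rw [add_assoc, Nat.add_sub_cancel_left, Nat.add_sub_cancel_left, pNum_succ, mul_add 2 k s,
          pow_add _ (2 * k)]
        field_simp
      cases k with
      | zero =>
        simp only [step, map_add, map_smul, hm, hu, hv, du, dv, hf, hf0, zero_mul, add_zero,
          mul_zero, zero_add, smul_mul_assoc, mul_smul_comm, hs 0 (Nat.zero_le _)]
        match_scalars
        field_simp
        ring
      | succ k =>
        simp only [step, map_add, map_smul, hm, hu, hv, du, dv, hf, zero_mul, add_zero,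
          smul_mul_assoc, mul_smul_comm]
        rcases lt_or_ge N (k + 1) with h | h
        · simp only [hz _ h, mul_zero, smul_zero, zero_add, add_zero, Nat.add_sub_add_right]
          match_scalars
          field_simp
          ring
        · have h3 := hs _ h
          rw [Nat.add_sub_add_right] at h3
          simp only [Nat.add_sub_add_right, h3]
          match_scalars <;> field_simp <;> ring
  refine (coactCoeff_induction (P := fun N f => (∀ k, N < k → f k = 0) ∧
    (rowDer q).adj (f 0) = 0 ∧ ∀ k, (rowDer q).adj (f (k + 1)) =
    (cq q ^ N * (cq q ^ (k + 1))⁻¹ * pNum q (N - k)) • f k) ?_ ?_ ?_ m n).2.2 k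
  · refine ⟨?_, ?_, ?_⟩
    · rintro (_ | k) hk <;> simp [coactCoeff] at *
    · simp [coactCoeff, TwistedDer.adj_one]
    · rintro (_ | k) <;> simp [coactCoeff, pNum]
  · obtain ⟨da, db, dc, dd⟩ := rowDer_adj q
    exact key _ _ (rowDer_κ q .a) (rowDer_κ q .c) da dc
  · obtain ⟨da, db, dc, dd⟩ := rowDer_adj q
    exact key _ _ (rowDer_κ q .b) (rowDer_κ q .d) db dd

/-! ### Weights and the degree filtration -/

theorem colDer_κ_coactCoeff (q : Param) (m n k : ℕ) :
    (colDer q).κ (coactCoeff q m n k) = cq q ^ ((m : ℤ) - n) • coactCoeff q m n k := by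
  have hq := cq_ne q
  obtain ⟨ka, kb, kc, kd⟩ := colDer_κ_gen q
  have h : (colDer q).κ ∘ coactCoeff q m n = cq q ^ ((m : ℤ) - n) • coactCoeff q m n := by
    induction m with
    | zero =>
      induction n with
      | zero => ext k; cases k <;> simp [coactCoeff]
      | succ n ih =>
        rw [coactCoeff_succ_right, map_step, ih, kb, kd, step_smul_left, step_smul, smul_smul]
        congr 1
        rw [← zpow_neg_one, ← zpow_add₀ hq]
        congr 1
        push_cast
        ring
    | succ m ih =>
      rw [coactCoeff_succ_left, map_step, ih, ka, kc, step_smul_left, step_smul, smul_smul]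
      congr 1
      rw [← zpow_one_add₀ hq]
      congr 1
      push_cast
      ring
  exact congrFun h k

theorem rowDer_κ_coactCoeff (q : Param) (m n k : ℕ) :
    (rowDer q).κ (coactCoeff q m n k) =
      cq q ^ (((m + n : ℕ) : ℤ) - 2 * k) • coactCoeff q m n k := by
  have hq := cq_ne q
  have key : ∀ u v : Coord q, (rowDer q).κ u = cq q • u → (rowDer q).κ v = (cq q)⁻¹ • v →
      ∀ (N : ℕ) f, (∀ k : ℕ, (rowDer q).κ (f k) = cq q ^ ((N : ℤ) - 2 * k) • f k) →
      ∀ k : ℕ, (rowDer q).κ (step q N u v f k) =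
        cq q ^ (((N + 1 : ℕ) : ℤ) - 2 * k) • step q N u v f k := by
    intro u v hu hv N f hf k
    cases k with
    | zero =>
      simp only [step, map_mul, hu, hf, smul_mul_assoc, mul_smul_comm, smul_smul]
      rw [← zpow_add_one₀ hq]
      congr 2
    | succ k =>
      simp only [step, map_add, map_smul, map_mul, hu, hv, hf, smul_mul_assoc, mul_smul_comm,
        smul_smul, smul_add]
      have e1 : ((N + 1 : ℕ) : ℤ) - 2 * (k + 1 : ℕ) = N - 2 * (k + 1 : ℕ) + 1 := by
        push_cast; ring
      have e2 : (N : ℤ) - 2 * k = N - 2 * (k + 1 : ℕ) + 1 + 1 := by push_cast; ring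
      rw [e1, e2, zpow_add_one₀ hq, zpow_add_one₀ hq]
      congr 2
      field_simp
  refine coactCoeff_induction (P := fun N f => ∀ k : ℕ, (rowDer q).κ (f k) =
    cq q ^ ((N : ℤ) - 2 * k) • f k) ?_ ?_ ?_ m n k
  · rintro (_ | k) <;> simp [coactCoeff]
  · exact key _ _ (rowDer_κ q .a) (rowDer_κ q .c)
  · exact key _ _ (rowDer_κ q .b) (rowDer_κ q .d)

/-- The elements of degree at most `d` in the generators. -/
def degreeLE (q : Param) (d : ℕ) : Submodule ℂ (Coord q) :=
  (1 ⊔ Submodule.span ℂ (Set.range (gen q))) ^ d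

theorem one_mem_degreeLE (q : Param) (d : ℕ) : 1 ∈ degreeLE q d := by
  have h : (1 : Submodule ℂ (Coord q)) ≤ degreeLE q d := one_le_pow_of_one_le' le_sup_left d
  exact h (Submodule.one_le.mp le_rfl)

theorem mul_mem_degreeLE {q : Param} {d e : ℕ} {x y : Coord q} (hx : x ∈ degreeLE q d)
    (hy : y ∈ degreeLE q e) : x * y ∈ degreeLE q (d + e) := by
  rw [degreeLE, pow_add]
  exact Submodule.mul_mem_mul hx hy

theorem gen_mem_degreeLE (q : Param) (g : Gen) : gen q g ∈ degreeLE q 1 := by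
  rw [degreeLE, pow_one]
  exact Submodule.mem_sup_right (Submodule.subset_span ⟨g, rfl⟩)

theorem degreeLE_mono (q : Param) {d e : ℕ} (h : d ≤ e) : degreeLE q d ≤ degreeLE q e := by
  intro x hx
  obtain ⟨s, rfl⟩ := Nat.exists_eq_add_of_le h
  simpa using mul_mem_degreeLE hx (one_mem_degreeLE q s)

theorem exists_mem_degreeLE {q : Param} (x : Coord q) : ∃ d, x ∈ degreeLE q d := by
  induction x using coord_induction with
  | hs z =>
    refine ⟨0, ?_⟩
    rw [Algebra.algebraMap_eq_smul_one]
    exact Submodule.smul_mem _ _ (one_mem_degreeLE q 0)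
  | hg g => exact ⟨1, gen_mem_degreeLE q g⟩
  | hadd x y hx hy =>
    obtain ⟨d, hd⟩ := hx
    obtain ⟨e, he⟩ := hy
    exact ⟨d + e, Submodule.add_mem _ (degreeLE_mono q (Nat.le_add_right d e) hd)
      (degreeLE_mono q (Nat.le_add_left e d) he)⟩
  | hmul x y hx hy =>
    obtain ⟨d, hd⟩ := hx
    obtain ⟨e, he⟩ := hy
    exact ⟨d + e, mul_mem_degreeLE hd he⟩

theorem coactCoeff_mem_degreeLE (q : Param) (m n k : ℕ) :
    coactCoeff q m n k ∈ degreeLE q (m + n) := by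
  have key : ∀ g g' (N : ℕ) f, (∀ k, f k ∈ degreeLE q N) →
      ∀ k, step q N (gen q g) (gen q g') f k ∈ degreeLE q (N + 1) := by
    intro g g' N f hf k
    rw [add_comm N]
    cases k with
    | zero => exact mul_mem_degreeLE (gen_mem_degreeLE q g) (hf 0)
    | succ k =>
      exact Submodule.add_mem _ (mul_mem_degreeLE (gen_mem_degreeLE q g) (hf _))
        (Submodule.smul_mem _ _ (mul_mem_degreeLE (gen_mem_degreeLE q g') (hf _)))
  refine coactCoeff_induction (P := fun N f => ∀ k, f k ∈ degreeLE q N) ?_ (key _ _) (key _ _) m n k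
  rintro (_ | k)
  · rw [coactCoeff]
    exact one_mem_degreeLE q 0
  · rw [coactCoeff]
    exact Submodule.zero_mem _

theorem colDer_adj_mem_degreeLE {q : Param} {d : ℕ} {x : Coord q} (hx : x ∈ degreeLE q d) :
    (colDer q).adj x ∈ degreeLE q d := by
  obtain ⟨da, dc, db, dd⟩ := colDer_adj q
  induction d generalizing x with
  | zero =>
    rw [degreeLE, pow_zero] at hx
    obtain ⟨z, rfl⟩ := Submodule.mem_one.mp hx
    rw [Algebra.algebraMap_eq_smul_one, map_smul, TwistedDer.adj_one, smul_zero]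
    exact Submodule.zero_mem _
  | succ d ih =>
    have h : degreeLE q (d + 1) ≤ (degreeLE q (d + 1)).comap (colDer q).adj := by
      conv_lhs => rw [degreeLE, pow_succ', ← degreeLE]
      have hκ : 1 ⊔ Submodule.span ℂ (Set.range (gen q)) ≤
          (degreeLE q 1).comap (colDer q).κ.toLinearMap := by
        rw [sup_le_iff, Submodule.one_le, Submodule.span_le]
        refine ⟨?_, ?_⟩
        · simpa using one_mem_degreeLE q 1
        · rintro _ ⟨g, rfl⟩
          cases g <;>
            simpa [colDer_κ_gen] using Submodule.smul_mem _ _ (gen_mem_degreeLE q _)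
      have hδ : 1 ⊔ Submodule.span ℂ (Set.range (gen q)) ≤
          (degreeLE q 1).comap (colDer q).adj := by
        rw [sup_le_iff, Submodule.one_le, Submodule.span_le]
        refine ⟨?_, ?_⟩
        · simp [TwistedDer.adj_one]
        · rintro _ ⟨g, rfl⟩
          cases g
          · simp [da]
          · simpa [db] using Submodule.smul_mem _ _ (gen_mem_degreeLE q _)
          · simp [dc]
          · simpa [dd] using Submodule.smul_mem _ _ (gen_mem_degreeLE q _)
      refine Submodule.mul_le.mpr fun x hx y hy => ?_
      rw [Submodule.mem_comap, TwistedDer.adj_mul, add_comm d]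
      exact Submodule.add_mem _ (mul_mem_degreeLE (hκ hx) (ih hy)) (mul_mem_degreeLE (hδ hx) hy)
    exact h hx

/-- An element of degree at most `d` is a sum of column weight vectors with weights in `[-d, d]`. -/
theorem degreeLE_le_span_weight (q : Param) (d : ℕ) : degreeLE q d ≤ Submodule.span ℂ
    {x | ∃ j : ℤ, |j| ≤ d ∧ (colDer q).κ x = cq q ^ j • x} := by
  have hq := cq_ne q
  induction d with
  | zero =>
    rw [degreeLE, pow_zero, Submodule.one_le]
    exact Submodule.subset_span ⟨0, by simp, by simp⟩
  | succ d ih =>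
    have h1 : 1 ⊔ Submodule.span ℂ (Set.range (gen q)) ≤ Submodule.span ℂ
        {x | ∃ j : ℤ, |j| ≤ 1 ∧ (colDer q).κ x = cq q ^ j • x} := by
      rw [sup_le_iff, Submodule.one_le, Submodule.span_le]
      refine ⟨Submodule.subset_span ⟨0, by simp, by simp⟩, ?_⟩
      rintro _ ⟨g, rfl⟩
      cases g
      · exact Submodule.subset_span ⟨1, by simp, by simp [colDer_κ_gen]⟩
      · exact Submodule.subset_span ⟨-1, by simp, by simp [colDer_κ_gen]⟩
      · exact Submodule.subset_span ⟨1, by simp, by simp [colDer_κ_gen]⟩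
      · exact Submodule.subset_span ⟨-1, by simp, by simp [colDer_κ_gen]⟩
    rw [degreeLE, pow_succ', ← degreeLE]
    refine (mul_le_mul' h1 ih).trans ?_
    rw [Submodule.span_mul_span, Submodule.span_le]
    rintro _ ⟨x, ⟨i, hi, hx⟩, y, ⟨j, hj, hy⟩, rfl⟩
    refine Submodule.subset_span ⟨i + j, (abs_add_le i j).trans (by push_cast; linarith), ?_⟩
    simp only [map_mul, hx, hy, smul_mul_assoc, mul_smul_comm, smul_smul, zpow_add₀ hq]
    rw [mul_comm (cq q ^ j)]

/-- The coefficients of the coaction in degree `m + n` are orthogonal to all elements of lower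
degree: this is clear by weights if `n = 0`, and the column derivation reduces to this case. -/
theorem haar_mul_star_coactCoeff_of_degree {q : Param} {d : ℕ} {x : Coord q}
    (hx : x ∈ degreeLE q d) (m n k : ℕ) (h : d < m + n) :
    haar q (x * star (coactCoeff q m n k)) = 0 := by
  induction n generalizing m x with
  | zero =>
    have hle : degreeLE q d ≤ LinearMap.ker
        (haar q ∘ₗ LinearMap.mulRight ℂ (star (coactCoeff q m 0 k))) := by
      refine (degreeLE_le_span_weight q d).trans (Submodule.span_le.mpr ?_)
      rintro y ⟨j, hj, hy⟩
      have hc := colDer_κ_coactCoeff q m 0 k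
      refine (colDer q).haar_mul_star_of_weight hy hc fun e => ?_
      have := (abs_le.mp hj).2
      push_cast at e
      omega
    exact hle hx
  | succ n ih =>
    have hz : cq q ^ m * (pNum q (m + 1) : ℂ) ≠ 0 :=
      mul_ne_zero (pow_ne_zero _ (cq_ne q)) (by exact_mod_cast (pNum_pos q m).ne')
    have e := congrFun (colDer_coactCoeff q m n) k
    simp only [Function.comp_apply, Pi.smul_apply] at e
    have h0 := ih (colDer_adj_mem_degreeLE hx) (m + 1) (by omega)
    rw [← TwistedDer.haar_mul_star_δ, e, star_smul, mul_smul_comm, map_smul, smul_eq_mul] at h0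
    exact (mul_eq_zero.mp h0).resolve_left (star_ne_zero.mpr hz)

/-! ### Schur orthogonality -/

theorem qFact_succ (q : Param) (n : ℕ) :
    qFact ((q : ℝ) ^ 2)⁻¹ (n + 1) = qFact ((q : ℝ) ^ 2)⁻¹ n * pNum q (n + 1) :=
  Finset.prod_range_succ _ _

theorem qBinom_pos (q : Param) (N k : ℕ) : 0 < qBinom ((q : ℝ) ^ 2)⁻¹ N k := by
  have hp : 0 < ((q : ℝ) ^ 2)⁻¹ := inv_pos.mpr (pow_pos (q_pos q) 2)
  exact div_pos (qFact_pos hp _) (mul_pos (qFact_pos hp _) (qFact_pos hp _))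

theorem qBinom_mul_pNum (q : Param) (m n : ℕ) :
    qBinom ((q : ℝ) ^ 2)⁻¹ (m + n + 1) (n + 1) * pNum q (n + 1) =
      qBinom ((q : ℝ) ^ 2)⁻¹ (m + n + 1) n * pNum q (m + 1) := by
  have hp : 0 < ((q : ℝ) ^ 2)⁻¹ := inv_pos.mpr (pow_pos (q_pos q) 2)
  have e1 : m + n + 1 - (n + 1) = m := by omega
  have e2 : m + n + 1 - n = m + 1 := by omega
  have h1 := (qFact_pos hp m).ne'
  have h2 := (qFact_pos hp n).ne'
  have h3 := (pNum_pos q m).ne'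
  have h4 := (pNum_pos q n).ne'
  rw [qBinom, qBinom, e1, e2, qFact_succ q m, qFact_succ q n]
  field_simp

theorem qBinom_self (q : Param) (N : ℕ) :
    qBinom ((q : ℝ) ^ 2)⁻¹ N N = qBinom ((q : ℝ) ^ 2)⁻¹ N 0 := by
  rw [qBinom, qBinom, Nat.sub_self, Nat.sub_zero, mul_comm]

theorem rootBinom_mul_self (q : Param) (N k : ℕ) :
    rootBinom q N k * rootBinom q N k = (qBinom ((q : ℝ) ^ 2)⁻¹ N k : ℂ) := by
  rw [rootBinom, ← Complex.ofReal_mul, Real.mul_self_sqrt (qBinom_pos q N k).le]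

theorem conj_pNum (q : Param) (n : ℕ) : conj (pNum q n : ℂ) = pNum q n := Complex.conj_ofReal _

theorem norm_coactCoeff_col (q : Param) (m n k : ℕ) :
    pNum q (m + 1) * haar q (coactCoeff q m (n + 1) k * star (coactCoeff q m (n + 1) k)) =
      cq q ^ 2 * (pNum q (n + 1) *
        haar q (coactCoeff q (m + 1) n k * star (coactCoeff q (m + 1) n k))) := by
  have hq := pow_ne_zero m (cq_ne q)
  have h := (colDer q).haar_δ_mul_star (coactCoeff q (m + 1) n k) (coactCoeff q m (n + 1) k)
  have e1 := congrFun (colDer_coactCoeff q m n) k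
  have e2 := congrFun (colDer_adj_coactCoeff q m n) k
  simp only [Function.comp_apply, Pi.smul_apply] at e1 e2
  rw [e1, e2, star_smul, smul_mul_assoc, mul_smul_comm, map_smul, map_smul, smul_eq_mul,
    smul_eq_mul, RCLike.star_def, map_mul (starRingEnd ℂ), map_pow, conj_cq, conj_pNum, pow_add] at h
  apply mul_left_cancel₀ hq
  linear_combination h

theorem norm_coactCoeff_row (q : Param) (m n k : ℕ) :
    pNum q (k + 1) * haar q (coactCoeff q m n (k + 1) * star (coactCoeff q m n (k + 1))) =
      pNum q (m + n - k) * haar q (coactCoeff q m n k * star (coactCoeff q m n k)) := by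
  have hq := mul_ne_zero (pow_ne_zero (m + n) (cq_ne q))
    (inv_ne_zero (pow_ne_zero (k + 1) (cq_ne q)))
  have h := (rowDer q).haar_δ_mul_star (coactCoeff q m n k) (coactCoeff q m n (k + 1))
  rw [rowDer_coactCoeff, rowDer_adj_coactCoeff, star_smul, smul_mul_assoc, mul_smul_comm, map_smul,
    map_smul, smul_eq_mul, smul_eq_mul, RCLike.star_def, map_mul (starRingEnd ℂ),
    map_mul (starRingEnd ℂ), map_inv₀, map_pow, map_pow, conj_cq, conj_pNum] at h
  apply mul_left_cancel₀ hq
  linear_combination h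

theorem coactCoeff_corner (q : Param) (N : ℕ) : coactCoeff q N 0 N = gen q .c ^ N := by
  induction N with
  | zero => rw [coactCoeff, pow_zero]
  | succ N ih => rw [coactCoeff, ih, coactCoeff_zero q N 0 (N + 1) (by omega), pow_succ']; simp

theorem haar_c_pow (q : Param) (N : ℕ) :
    haar q (gen q .c ^ N * star (gen q .c ^ N)) = (cq q ^ N * qNum q (N + 1))⁻¹ := by
  have hq := cq_ne q
  have hrep : ∀ (n : ℕ), rep q (star (gen q .c ^ N)) (basisVec (n, 0)) =
      Finsupp.single (n, -(N : ℤ)) (cq q ^ (n * N)) := by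
    intro n
    induction N with
    | zero => simp
    | succ N ih =>
      rw [pow_succ, star_mul, map_mul, Module.End.mul_apply, ih, coord_star_gen, starGen, map_smul,
        rep_gen, repGen, LinearMap.smul_apply, wshift_single, Finsupp.smul_single]
      congr 1
      · push_cast
        ext <;> simp
        ring
      · rw [smul_eq_mul]
        field_simp
        ring
  have hterm : haarTerm q (gen q .c ^ N * star (gen q .c ^ N)) =
      fun n => (1 - cq q ^ 2) * (cq q ^ (2 * (N + 1))) ^ n := by
    ext n
    rw [haarTerm_mul_star, hrep, form_single_left, Finsupp.single_eq_same, map_pow, conj_cq]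
    ring
  have h1 : ‖cq q ^ (2 * (N + 1))‖ < 1 := by
    rw [norm_pow, norm_cq]
    exact pow_lt_one₀ (q_pos q).le (q_lt q) (by omega)
  have h2 := one_sub_ne q 2 two_ne_zero
  have h3 := one_sub_ne q (2 * (N + 1)) (by omega)
  rw [haar_apply, hterm, tsum_mul_left, tsum_geometric_of_norm_lt_one h1, qNum]
  have e1 : cq q - (cq q)⁻¹ = -(1 - cq q ^ 2) * (cq q)⁻¹ := by field_simp; ring
  have e2 : cq q ^ (N + 1) - (cq q ^ (N + 1))⁻¹ =
      -(1 - cq q ^ (2 * (N + 1))) * (cq q ^ (N + 1))⁻¹ := by field_simp; ring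
  rw [e1, e2]
  field_simp
  ring

theorem qNum_ne (q : Param) (N : ℕ) : qNum q (N + 1) ≠ 0 := by
  have hq := cq_ne q
  have key : ∀ n, n ≠ 0 → cq q ^ n - (cq q ^ n)⁻¹ ≠ 0 := fun n hn => by
    have h := one_sub_ne q (2 * n) (by omega)
    have e : cq q ^ n - (cq q ^ n)⁻¹ = -(1 - cq q ^ (2 * n)) * (cq q ^ n)⁻¹ := by
      field_simp; ring
    rw [e]
    exact mul_ne_zero (neg_ne_zero.mpr h) (inv_ne_zero (pow_ne_zero _ hq))
  have h1 := key 1 one_ne_zero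
  rw [pow_one] at h1
  exact div_ne_zero (key _ (Nat.succ_ne_zero N)) h1

theorem norm_tMat (q : Param) (N : ℕ) (i j : Fin (N + 1)) :
    haar q (tMat q N i j * star (tMat q N i j)) = cq q ^ idx N j * (qNum q (N + 1))⁻¹ := by
  have hq := cq_ne q
  have hB : ∀ k, (qBinom ((q : ℝ) ^ 2)⁻¹ N k : ℂ) ≠ 0 := fun k => by
    exact_mod_cast (qBinom_pos q N k).ne'
  -- the norm does not depend on the row, and is computed in the last row of the first column
  have hrow : ∀ s k, k + s = N → haar q (coactCoeff q N 0 k * star (coactCoeff q N 0 k)) =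
      qBinom ((q : ℝ) ^ 2)⁻¹ N k / qBinom ((q : ℝ) ^ 2)⁻¹ N 0 *
        (cq q ^ N * qNum q (N + 1))⁻¹ := by
    intro s
    induction s with
    | zero =>
      rintro k rfl
      rw [Nat.add_zero, coactCoeff_corner, haar_c_pow, qBinom_self, div_self, one_mul]
      exact_mod_cast (qBinom_pos q k 0).ne'
    | succ s ih =>
      intro k hk
      have h1 := norm_coactCoeff_row q N 0 k
      rw [ih (k + 1) (by omega)] at h1
      have h2 := qBinom_mul_pNum q s k
      have e1 : s + k + 1 = N := by omega
      have e2 : N + 0 - k = s + 1 := by omega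
      rw [e1] at h2
      rw [e2] at h1
      have h2' : (qBinom ((q : ℝ) ^ 2)⁻¹ N (k + 1) : ℂ) * pNum q (k + 1) =
        qBinom ((q : ℝ) ^ 2)⁻¹ N k * pNum q (s + 1) := by exact_mod_cast h2
      have h3 : (pNum q (s + 1) : ℂ) ≠ 0 := by exact_mod_cast (pNum_pos q s).ne'
      apply mul_left_cancel₀ h3
      rw [← h1]
      linear_combination (cq q ^ N * qNum q (N + 1))⁻¹ / qBinom ((q : ℝ) ^ 2)⁻¹ N 0 * h2'
  have hcol : ∀ n m, m + n = N → haar q (coactCoeff q m n i * star (coactCoeff q m n i)) =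
      qBinom ((q : ℝ) ^ 2)⁻¹ N i / qBinom ((q : ℝ) ^ 2)⁻¹ N n *
        (cq q ^ (2 * n) * (cq q ^ N * qNum q (N + 1))⁻¹) := by
    intro n
    induction n with
    | zero =>
      intro m hm
      rw [Nat.add_zero] at hm
      subst hm
      rw [hrow (m - i) i (by omega)]
      simp
    | succ n ih =>
      intro m hm
      -- the column step contributes `q²` and a ratio of binomial coefficients
      have h1 := norm_coactCoeff_col q m n i
      rw [ih (m + 1) (by omega)] at h1
      have h2 := qBinom_mul_pNum q m n
      have e1 : m + n + 1 = N := by omega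
      rw [e1] at h2
      have h2' : (qBinom ((q : ℝ) ^ 2)⁻¹ N (n + 1) : ℂ) * pNum q (n + 1) =
        qBinom ((q : ℝ) ^ 2)⁻¹ N n * pNum q (m + 1) := by exact_mod_cast h2
      have h3 : (pNum q (m + 1) : ℂ) ≠ 0 := by exact_mod_cast (pNum_pos q m).ne'
      have h4 := hB n
      have h5 := hB (n + 1)
      apply mul_left_cancel₀ h3
      rw [h1]
      have h6 : (pNum q (n + 1) : ℂ) =
          qBinom ((q : ℝ) ^ 2)⁻¹ N n * pNum q (m + 1) / qBinom ((q : ℝ) ^ 2)⁻¹ N (n + 1) := by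
        rw [← h2', mul_div_cancel_left₀ _ h5]
      rw [h6]
      generalize ((qBinom ((q : ℝ) ^ 2)⁻¹ N n : ℝ) : ℂ) = x at h4 ⊢
      generalize ((qBinom ((q : ℝ) ^ 2)⁻¹ N (n + 1) : ℝ) : ℂ) = y at h5 ⊢
      field_simp
      ring
  have hi : rootBinom q N i ≠ 0 := rootBinom_ne q N i
  have hj : rootBinom q N j ≠ 0 := rootBinom_ne q N j
  have hconj : conj (rootBinom q N j / rootBinom q N i) = rootBinom q N j / rootBinom q N i := by
    rw [map_div₀, rootBinom, rootBinom, Complex.conj_ofReal, Complex.conj_ofReal]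
  have hidx : cq q ^ idx N j = cq q ^ (2 * (j : ℕ)) * (cq q ^ N)⁻¹ := by
    rw [idx, zpow_sub₀ hq, div_eq_mul_inv, zpow_natCast]
    norm_cast
  rw [tMat, Matrix.of_apply, star_smul, smul_mul_assoc, mul_smul_comm, smul_smul, map_smul,
    RCLike.star_def, hconj, hcol j (N - j) (by omega), smul_eq_mul, ← rootBinom_mul_self,
    ← rootBinom_mul_self, hidx, mul_inv]
  field_simp

/-- Schur orthogonality for the matrix entries of the irreducible corepresentations. -/
theorem haar_tMat_mul_star (q : Param) (N : ℕ) (i j k l : Fin (N + 1)) :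
    haar q (tMat q N i j * star (tMat q N k l)) =
      if i = k ∧ j = l then cq q ^ idx N j * (qNum q (N + 1))⁻¹ else 0 := by
  split_ifs with h
  · rw [← h.1, ← h.2, norm_tMat]
  · simp only [tMat, Matrix.of_apply, star_smul, smul_mul_assoc, mul_smul_comm, map_smul]
    -- off the diagonal, the row weights or the column weights differ
    have h0 : haar q (coactCoeff q (N - j) j i * star (coactCoeff q (N - l) l k)) = 0 := by
      by_cases hi : i = k
      · refine (colDer q).haar_mul_star_of_weight (colDer_κ_coactCoeff q _ _ _)
          (colDer_κ_coactCoeff q _ _ _) fun e => h ⟨hi, Fin.ext ?_⟩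
        omega
      · refine (rowDer q).haar_mul_star_of_weight (rowDer_κ_coactCoeff q _ _ _)
          (rowDer_κ_coactCoeff q _ _ _) fun e => hi (Fin.ext ?_)
        omega
    rw [h0, smul_zero, smul_zero]

theorem tMat_mem_degreeLE (q : Param) (N : ℕ) (i j : Fin (N + 1)) :
    tMat q N i j ∈ degreeLE q N := by
  have h := coactCoeff_mem_degreeLE q (N - j) j i
  rw [Nat.sub_add_cancel (by omega)] at h
  exact Submodule.smul_mem _ _ h

theorem haar_mul_star_tMat_of_degree {q : Param} {d N : ℕ} {x : Coord q} (hx : x ∈ degreeLE q d)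
    (h : d < N) (i j : Fin (N + 1)) : haar q (x * star (tMat q N i j)) = 0 := by
  rw [tMat, Matrix.of_apply, star_smul, mul_smul_comm, map_smul,
    haar_mul_star_coactCoeff_of_degree hx _ _ _ (by omega), smul_zero]

theorem haar_tMat_mul_star_of_ne (q : Param) {N M : ℕ} (h : N ≠ M) (i j : Fin (N + 1))
    (k l : Fin (M + 1)) : haar q (tMat q N i j * star (tMat q M k l)) = 0 := by
  rcases lt_or_gt_of_ne h with h | h
  · exact haar_mul_star_tMat_of_degree (tMat_mem_degreeLE q N i j) h k l
  · rw [← haar_conj, haar_mul_star_tMat_of_degree (tMat_mem_degreeLE q M k l) h i j, map_zero]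

/-! ### Fourier coefficients and the composition formula -/

theorem qTrace_mul_tMat (q : Param) (N : ℕ) (S : Matrix (Fin (N + 1)) (Fin (N + 1)) ℂ) :
    qTrace q N (S.map (algebraMap ℂ (Coord q)) * tMat q N) =
      ∑ i, ∑ j, (cq q ^ (-idx N i) * S i j) • tMat q N j i := by
  simp only [qTrace, dMat, Matrix.diagonal_map (map_zero (algebraMap ℂ (Coord q))), Matrix.trace,
    Matrix.diag_apply, Matrix.diagonal_mul]
  simp only [Matrix.mul_apply, Matrix.map_apply, Finset.mul_sum, mul_assoc, ← Algebra.smul_def,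
    smul_smul]

/-- The summand of a pseudo-differential operator, for a symbol with scalar entries. -/
theorem opTerm_of_scalar {q : Param} {σ : Symb q} {N : ℕ}
    {S : Matrix (Fin (N + 1)) (Fin (N + 1)) ℂ} (hS : σ N = S.map (algebraMap ℂ (Coord q)))
    (f : L2 q) : opTerm q σ f N = qNum q (N + 1) •
      ∑ i, ∑ j, (cq q ^ (-idx N i) * (S * fourier q f N) i j) • tMat q N j i := by
  rw [opTerm, hS, ← Matrix.map_mul, qTrace_mul_tMat]

/-- Schur orthogonality in the form of an inversion formula: the Fourier coefficients of the
summand of `A f` are those of `f`, multiplied by the symbol. -/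
theorem fourier_opTerm {q : Param} {σ : Symb q} {N : ℕ}
    {S : Matrix (Fin (N + 1)) (Fin (N + 1)) ℂ} (hS : σ N = S.map (algebraMap ℂ (Coord q)))
    (f : L2 q) : fourier q (toL2 q (opTerm q σ f N)) N = S * fourier q f N := by
  have hn := qNum_ne q N
  ext m n
  have hm := zpow_ne_zero (idx N m) (cq_ne q)
  rw [fourier_toL2, opTerm_of_scalar hS]
  simp only [smul_mul_assoc, Finset.sum_mul, map_smul, map_sum, haar_tMat_mul_star, smul_eq_mul]
  rw [Finset.sum_eq_single m, Finset.sum_eq_single n]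
  · rw [if_pos ⟨rfl, rfl⟩, zpow_neg]
    field_simp
  · intro j _ hj
    rw [if_neg fun h => hj h.1, mul_zero]
  · simp
  · intro i _ hi
    exact Finset.sum_eq_zero fun j _ => by rw [if_neg fun h => hi h.2, mul_zero]
  · simp

theorem fourier_opTerm_of_ne {q : Param} {σ : Symb q} {N M : ℕ}
    {S : Matrix (Fin (N + 1)) (Fin (N + 1)) ℂ} (hS : σ N = S.map (algebraMap ℂ (Coord q)))
    (f : L2 q) (h : N ≠ M) : fourier q (toL2 q (opTerm q σ f N)) M = 0 := by
  ext m n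
  rw [fourier_toL2, opTerm_of_scalar hS]
  simp [smul_mul_assoc, Finset.sum_mul, haar_tMat_mul_star_of_ne q h]

/-- The Fourier transform of an element of the coordinate algebra has finite support. -/
theorem exists_fourier_toL2_eq_zero {q : Param} (x : Coord q) :
    ∃ d, ∀ N, d < N → fourier q (toL2 q x) N = 0 := by
  obtain ⟨d, hd⟩ := exists_mem_degreeLE x
  refine ⟨d, fun N hN => ?_⟩
  ext m n
  rw [fourier_toL2, haar_mul_star_tMat_of_degree hd hN, Matrix.zero_apply]

theorem tMat_zero (q : Param) (r s : Fin 1) : tMat q 0 r s = 1 := by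
  rw [Subsingleton.elim r 0, Subsingleton.elim s 0, tMat, Matrix.of_apply,
    div_self (rootBinom_ne q 0 _), one_smul]
  change coactCoeff q 0 0 0 = 1
  rw [coactCoeff]

/-- Symbols of Fourier order zero have scalar entries. -/
theorem exists_scalar_of_mem_symbClass {q : Param} {σ : Symb q} (h : σ ∈ symbClass q 0) (N : ℕ) :
    ∃ S : Matrix (Fin (N + 1)) (Fin (N + 1)) ℂ, σ N = S.map (algebraMap ℂ (Coord q)) := by
  have key : ∀ i j, σ N i j ∈ (1 : Submodule ℂ (Coord q)) := by
    intro i j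
    induction h using Submodule.span_induction with
    | mem σ hσ =>
      obtain ⟨ψ, hψ⟩ := hσ
      obtain ⟨h1, h2⟩ := hψ N i j
      by_cases he : ∃ r s : Fin 1, ψ N (i, j) = (idx 0 r, idx 0 s)
      · obtain ⟨r, s, he⟩ := he
        have := h1 r s he
        rwa [tMat_zero, ← Submodule.one_eq_span] at this
      · push Not at he
        rw [h2 he]
        exact Submodule.zero_mem _
    | zero => exact Submodule.zero_mem _
    | add σ τ _ _ hσ hτ => exact Submodule.add_mem _ hσ hτ
    | smul z σ _ hσ => exact Submodule.smul_mem _ z hσ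
  choose S hS using fun i j => Submodule.mem_one.mp (key i j)
  exact ⟨Matrix.of S, by ext i j; exact (hS i j).symm⟩

/-- A pseudo-differential operator whose symbol has scalar entries is a Fourier multiplier. -/
theorem HasSymbol.fourier_apply {q : Param} {B : L2 q →ₗ.[ℂ] L2 q} {σ : Symb q}
    (hB : HasSymbol q B σ) (hσ : σ ∈ symbClass q 0) (f : B.domain) (M : ℕ) :
    (fourier q (B f) M).map (algebraMap ℂ (Coord q)) =
      σ M * (fourier q f M).map (algebraMap ℂ (Coord q)) := by
  obtain ⟨S, hS⟩ := exists_scalar_of_mem_symbClass hσ M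
  rw [hS, ← Matrix.map_mul]
  congr 1
  rw [← fourier_opTerm hS]
  ext m n
  have h := (hB.hasSum f).mapL (innerSL ℂ (toL2 q (tMat q M n m)))
  refine h.unique (hasSum_single M fun N hN => ?_)
  obtain ⟨S', hS'⟩ := exists_scalar_of_mem_symbClass hσ N
  exact congrFun (congrFun (fourier_opTerm_of_ne hS' (f : L2 q) hN) m) n

/-- An operator with a symbol maps the coordinate algebra to itself. -/
theorem HasSymbol.exists_apply_toL2 {q : Param} {B : L2 q →ₗ.[ℂ] L2 q} {σ : Symb q}
    (hB : HasSymbol q B σ) (x : Coord q) : ∃ y, B ⟨toL2 q x, hB.coord_mem x⟩ = toL2 q y := by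
  obtain ⟨d, hd⟩ := exists_fourier_toL2_eq_zero x
  refine ⟨∑ N ∈ Finset.range (d + 1), opTerm q σ (toL2 q x) N, ?_⟩
  rw [map_sum]
  refine (hB.hasSum ⟨toL2 q x, hB.coord_mem x⟩).unique (hasSum_sum_of_ne_finset_zero fun N hN => ?_)
  have h0 := hd N (by simpa using hN)
  simp [opTerm, h0, qTrace]

end SUq2
end

theorem mainTheorem3 (q : SUq2.Param) (A B : SUq2.L2 q →ₗ.[ℂ] SUq2.L2 q) (σA σB : SUq2.Symb q)
    (hA : SUq2.HasSymbol q A σA) (hB : SUq2.HasSymbol q B σB)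
    (hσA : σA ∈ SUq2.symbClass q 0) (hσB : σB ∈ SUq2.symbClass q 0) :
    SUq2.IsPseudoDifferential q (SUq2.opComp A B) ∧
      SUq2.HasSymbol q (SUq2.opComp A B) (fun N => σA N * σB N) := by
  have h : SUq2.HasSymbol q (SUq2.opComp A B) (fun N => σA N * σB N) := by
    refine ⟨fun x => ?_, fun f => ?_⟩
    · obtain ⟨y, hy⟩ := hB.exists_apply_toL2 x
      rw [SUq2.mem_opComp_domain]
      exact ⟨hB.coord_mem x, hy ▸ hA.coord_mem y⟩
    · obtain ⟨hf, hBf⟩ := (SUq2.mem_opComp_domain A B _).mp f.2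
      rw [SUq2.opComp_apply A B f f.2 hf hBf]
      -- the series of `A (B f)` involves `B f` only through its Fourier coefficients
      have hs := hA.hasSum ⟨B ⟨f, hf⟩, hBf⟩
      have e : ∀ N, SUq2.opTerm q (fun N => σA N * σB N) f N =
          SUq2.opTerm q σA (B ⟨f, hf⟩) N := fun N => by
        rw [SUq2.opTerm, SUq2.opTerm, hB.fourier_apply hσB, Matrix.mul_assoc (σA N)]
      simpa only [e] using hs
  exact ⟨⟨_, h⟩, h⟩
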